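/- Let $p$ be a prime, $n\ge 1$, and write $[u]_p$ for the largest $k$ with $p^k\mid u$ and $o(\sigma)$ for the order of a group element. Let $\mathbf M(n,p)$ be a set of representatives of the conjugacy classes of those $\sigma\in \mathrm{GL}(n,p)$ whose minimal polynomial has degree $n$ and for which $-I\in\langle\sigma\rangle$. Let $\mathbf M_1(n,p)$ be the set of $\sigma\in\mathbf M(n,p)$ such that $p\mid o(\sigma)$ and $\sigma^{o(\sigma)/p}$ fixes an $(n-1)$-dimensional subspace of $\mathbb F_p^n$ pointwise. Let $M(n,p)$ and $M_1(n,p)$ be the sets of minimal polynomials of the elements of $\mathbf M(n,p)$ and $\mathbf M_1(n,p)$, respectively. For $f\in\mathbb F_p[x]$ with $f(0)\neq0$ let $\mathrm{ord}(f)$ be the least $e\ge1$ with $f\mid x^e-1$. For $i,j\ge 1$ let $A_{ij}$ be the set of monic irreducible $f\in\mathbb F_p[x]$ of degree $i$ with $f(0)\ne 0$ and $[\mathrm{ord}(f)]_2=j$ (empty if $2^j\nmid p^i-1$), and let $d=\max\{[p^i-1]_2 : 1\le i\le n\}$. **(1)** If $p$ is odd, then $$M(n,p)=\bigcup_{j=1}^{d}\Big\{\prod_{i=1}^{n}\prod_{g\in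 A_{ij}}g^{k_g}\ :\ k_g\in\mathbb Z_{\ge0},\ \sum_{i=1}^n\sum_{g\in A_{ij}}k_g\,i=n\Big\}.$$ **(2)** If $p$ is odd, then $M_1(n,p)$ consists of those $f\in M(n,p)$, $f$ the minimal polynomial of $\sigma\in\mathbf M(n,p)$, $f=\prod_{i=1}^n\prod_{g\in A_{ij}}g^{k_g}$ as in (1), for which $[o(\sigma)]_p\ge1$ and there is a unique $g\in A_{1j}$ such that $k_g=p^{[o(\sigma)]_p-1}+1$ and $t_h<[o(\sigma)]_p$ for every other $h\in\bigcup_{i\le n}A_{ij}$, where $t_h$ is the least integer $t\ge0$ with $p^{t}\ge k_h$. **(3)** A Cayley map $CM(G,S,\rho)$ of a group $G$ is given by a generating set $S=S^{-1}\not\ni1$ of $G$ and a cyclic permutation $\rho$ of $S$; its darts are the pairs $(g,gs)$ with $g\in G$, $s\in S$, its rotation sends $(g,gs)$ to $(g,g\rho(s))$, and its automorphisms are the permutations of the darts commuting with the rotation and with the reversal $(g,gs)\mapsto(gs,g)$. It is regular if its automorphism group $X$ is transitive on darts; $G$ is regarded as a subgroup of $X$ by left multiplication. If $X$ has a normal subgroup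 $T\cong\mathbb Z_p^n$ acting regularly on the vertices, identify $T$ with $\mathbb F_p^n$, and say that the map and $T$ *belong to* $\sigma\in\mathrm{GL}(n,p)$ if the automorphism fixing the vertex $1$ and sending $(1,s)$ to $(1,\rho(s))$ for all $s\in S$ acts on $T$ by conjugation as $\sigma$ (for a suitable identification). For every $\sigma\in\mathrm{GL}(n,p)$, the following are equivalent: * there are a group $G\cong\mathbb Z_p^n$, a regular Cayley map of $G$ and a subgroup $T$ of its automorphism group as above, belonging to $\sigma$, such that $T\cap G\cong\mathbb Z_p^{n-1}$; * $p\ne2$ and $\sigma$ is conjugate to an element of $\mathbf M_1(n,p)$ (that is, $\sigma\in\mathbf M_1(n,p)$ for a suitable choice of basis and representatives); * $p\neq 2$ and the minimal polynomial of $\sigma$ lies in $M_1(n,p)$. Moreover, if a regular Cayley map of a group isomorphic to $\mathbb Z_p^n$ and a normal subgroup $T$ as above belong to $\sigma$, then its automorphism group has a vertex-regular subgroup $H\cong\mathbb Z_p^n$ with $T\cap H\cong\mathbb Z_p^{n-1}$ if and only if $p\neq2$ and $\sigma$ is conjugate to an element of $\mathbf M_1(n,p)$. -/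

import Mathlib

open Polynomial

/-! ### The sets of linear transformations and their minimal polynomials -/

/-- The group `GL(n,p)` of invertible linear transformations of the space `𝔽_p^n`. -/
abbrev GLnp (n p : ℕ) : Type :=
  LinearMap.GeneralLinearGroup (ZMod p) (Fin n → ZMod p)

/-- The minimal polynomial of `σ ∈ GL(n,p)` over `𝔽_p`. -/
noncomputable def minPoly {n p : ℕ} (σ : GLnp n p) : (ZMod p)[X] :=
  minpoly (ZMod p) (σ : Module.End (ZMod p) (Fin n → ZMod p))

/-- The minimal polynomial of `σ` has degree `n` and `-I ∈ ⟨σ⟩`. -/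
def HasMType {n p : ℕ} (σ : GLnp n p) : Prop :=
  (minPoly σ).natDegree = n ∧ (-1 : GLnp n p) ∈ Subgroup.zpowers σ

/-- `M` is a set of representatives, one for each conjugacy class of `GL(n,p)` consisting of
transformations whose minimal polynomial has degree `n` and whose powers include `-I`.
This is the set written `𝐌(n,p)`. -/
def IsBoldM {n p : ℕ} (M : Set (GLnp n p)) : Prop :=
  (∀ σ ∈ M, HasMType σ) ∧ ∀ σ : GLnp n p, HasMType σ → ∃! τ, τ ∈ M ∧ IsConj σ τ

/-- The subset `𝐌₁(n,p)` of `𝐌(n,p)`: those `σ` with `p ∣ o(σ)` such that `σ^{o(σ)/p}` fixes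
pointwise a subspace of dimension `n-1`. -/
def boldM₁ {n p : ℕ} (M : Set (GLnp n p)) : Set (GLnp n p) :=
  {σ | σ ∈ M ∧ p ∣ orderOf σ ∧
    ∃ W : Submodule (ZMod p) (Fin n → ZMod p), Module.finrank (ZMod p) W = n - 1 ∧
      ∀ w ∈ W, ((σ ^ (orderOf σ / p) : GLnp n p) :
        Module.End (ZMod p) (Fin n → ZMod p)) w = w}

/-- The order of a polynomial `f` with `f(0) ≠ 0`: the least `e ≥ 1` with `f ∣ X^e - 1`. -/
noncomputable def polyOrd {p : ℕ} (f : (ZMod p)[X]) : ℕ :=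
  sInf {e : ℕ | 1 ≤ e ∧ f ∣ X ^ e - 1}

/-- The set `A_{ij}` of monic irreducible polynomials of degree `i` over `𝔽_p`, of nonzero constant
term, whose order has `2`-adic valuation `j`, where `j ≥ 1` and `2^j ∣ p^i - 1`. -/
def setA (p i j : ℕ) : Set (ZMod p)[X] :=
  {f | 1 ≤ j ∧ 2 ^ j ∣ p ^ i - 1 ∧ f.Monic ∧ f.natDegree = i ∧ Irreducible f ∧
    f.eval 0 ≠ 0 ∧ padicValNat 2 (polyOrd f) = j}

theorem setA_finite (p i j : ℕ) [Fact p.Prime] : (setA p i j).Finite := by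
  have h : Set.InjOn (fun (f : (ZMod p)[X]) (m : Fin (i + 1)) => f.coeff m) (setA p i j) := by
    intro f hf g hg hfg
    ext m
    by_cases hm : m < i + 1
    · exact congrFun hfg ⟨m, hm⟩
    · rw [coeff_eq_zero_of_natDegree_lt (by rw [hf.2.2.2.1]; omega),
        coeff_eq_zero_of_natDegree_lt (by rw [hg.2.2.2.1]; omega)]
  exact Set.Finite.of_finite_image (Set.toFinite _) h

/-- `A_{ij}` as a finite set. -/
noncomputable def finA (p i j : ℕ) [Fact p.Prime] : Finset (ZMod p)[X] :=
  (setA_finite p i j).toFinset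

/-- `d = max {[p^i - 1]_2 ∣ 1 ≤ i ≤ n}`. -/
noncomputable def dMax (n p : ℕ) : ℕ :=
  (Finset.Icc 1 n).sup fun i => padicValNat 2 (p ^ i - 1)

/-- `f = ∏_{i=1}^n ∏_{g ∈ A_{ij}} g^{k(g)}` with `∑_{i=1}^n ∑_{g ∈ A_{ij}} k(g) i = n`;
the exponents may be zero. -/
def IsFactorization (n p j : ℕ) [Fact p.Prime] (k : (ZMod p)[X] → ℕ) (f : (ZMod p)[X]) : Prop :=
  f = ∏ i ∈ Finset.Icc 1 n, ∏ g ∈ finA p i j, g ^ k g ∧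
    ∑ i ∈ Finset.Icc 1 n, ∑ g ∈ finA p i j, k g * i = n

/-- The exponents `k` single out, with respect to the order `o`, a linear factor `g ∈ A_{1j}`:
`[o]_p ≥ 1`, there is a unique `g ∈ A_{1j}` whose exponent is `p^{[o]_p - 1} + 1` and such that
every other factor `h` has `t_h < [o]_p`, where `t_h` is the least `t` with `k(h) ≤ p^t`. -/
def HasDominantLinearFactor (n p j o : ℕ) [Fact p.Prime] (k : (ZMod p)[X] → ℕ) : Prop :=
  1 ≤ padicValNat p o ∧
    ∃! g : (ZMod p)[X], g ∈ finA p 1 j ∧ k g = p ^ (padicValNat p o - 1) + 1 ∧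
      ∀ i ∈ Finset.Icc 1 n, ∀ h ∈ finA p i j, h ≠ g → Nat.clog p (k h) < padicValNat p o

/-! ### Regular Cayley maps -/

/-- A Cayley map `CM(G, S, ρ)`: a generating set `S = S⁻¹` with `1 ∉ S` and a cyclic
permutation `ρ` of `S`. -/
structure CayleyMap (G : Type*) [Group G] where
  /-- the connection set -/
  S : Set G
  closure_eq_top : Subgroup.closure S = ⊤
  inv_mem : ∀ s ∈ S, s⁻¹ ∈ S
  one_notMem : (1 : G) ∉ S
  /-- the cyclic permutation -/
  ρ : Equiv.Perm S
  sameCycle : ∀ s t : S, ρ.SameCycle s t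

namespace CayleyMap

variable {G : Type*} [Group G] (C : CayleyMap G)

/-- The darts: `(g, s)` stands for the dart from `g` to `g s`. -/
abbrev Dart : Type _ := G × C.S

/-- The rotation, sending the dart `(g, gs)` to `(g, gρ(s))`. -/
def rot : Equiv.Perm C.Dart := Equiv.prodCongr (Equiv.refl G) C.ρ

/-- The dart-reversing involution, sending `(g, gs)` to `(gs, g)`. -/
def rev : Equiv.Perm C.Dart where
  toFun d := (d.1 * d.2, ⟨(d.2 : G)⁻¹, C.inv_mem _ d.2.2⟩)
  invFun d := (d.1 * d.2, ⟨(d.2 : G)⁻¹, C.inv_mem _ d.2.2⟩)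
  left_inv d := by ext <;> simp
  right_inv d := by ext <;> simp

/-- The group of (orientation-preserving) automorphisms of the map: the permutations of the darts
commuting with the rotation and with the dart-reversing involution. -/
def aut : Subgroup (Equiv.Perm C.Dart) := Subgroup.centralizer {C.rot, C.rev}

/-- The map is regular: its automorphism group is transitive on darts. -/
def IsRegular : Prop := ∀ d d' : C.Dart, ∃ φ ∈ C.aut, φ d = d'

/-- Left translation by `g` on darts. -/
def leftMul (g : G) : Equiv.Perm C.Dart := Equiv.prodCongr (Equiv.mulLeft g) (Equiv.refl C.S)

theorem leftMul_mem (g : G) : C.leftMul g ∈ C.aut := by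
  rw [aut, Subgroup.mem_centralizer_iff]
  rintro h (rfl | rfl)
  · rfl
  · refine Equiv.ext fun d => Prod.ext ?_ rfl
    exact mul_assoc g d.1 d.2

/-- The left regular representation of `G` in the automorphism group of the map. -/
def leftHom : G →* C.aut where
  toFun g := ⟨C.leftMul g, C.leftMul_mem g⟩
  map_one' := by
    refine Subtype.ext (Equiv.ext fun d => Prod.ext ?_ rfl)
    exact one_mul d.1
  map_mul' g h := by
    refine Subtype.ext (Equiv.ext fun d => Prod.ext ?_ rfl)
    exact mul_assoc g h d.1

/-- The group `G`, as a subgroup of the automorphism group of the map. -/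
def groupImage : Subgroup C.aut := C.leftHom.range

/-- The automorphism `φ` sends the vertex `g` to the vertex `h`. -/
def MapsVertex (φ : C.aut) (g h : G) : Prop := ∀ s : C.S, (φ.1 (g, s)).1 = h

/-- A subgroup of the automorphism group acts regularly on the vertices. -/
def VertexRegular (H : Subgroup C.aut) : Prop :=
  ∀ g h : G, ∃! φ : C.aut, φ ∈ H ∧ C.MapsVertex φ g h

/-- `T` is a normal vertex-regular subgroup of the automorphism group, and under some
identification `e` of `T` with the vector space `𝔽_p^n` the generator `r` of the stabiliser of the
vertex `1` which induces the local rotation `ρ` there acts on `T` by conjugation as the linear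
transformation `σ`. (Permutations are composed from right to left, so conjugation by `r` is
`t ↦ r t r⁻¹`.) -/
def ActsAs {n p : ℕ} (T : Subgroup C.aut) (σ : GLnp n p) : Prop :=
  T.Normal ∧ C.VertexRegular T ∧
    ∃ r : C.aut, (∀ s : C.S, r.1 (1, s) = (1, C.ρ s)) ∧
      ∃ e : Multiplicative (Fin n → ZMod p) ≃* T, ∀ v : Fin n → ZMod p,
        (e (Multiplicative.ofAdd
          ((σ : Module.End (ZMod p) (Fin n → ZMod p)) v)) : C.aut) =
          r * (e (Multiplicative.ofAdd v) : C.aut) * r⁻¹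

end CayleyMap

/-- The group is isomorphic to `ℤ_p^n`. -/
def IsElemAb (p n : ℕ) (H : Type*) [Group H] : Prop :=
  Nonempty (H ≃* Multiplicative (Fin n → ZMod p))

/-- The case `T ∩ G ≅ ℤ_p^{n-1}` happens for `σ ∈ GL(n,p)`: there is a regular Cayley map of a group
`G ≅ ℤ_p^n` whose automorphism group has a normal vertex-regular subgroup `T ≅ ℤ_p^n`, on which
the local rotation at `1` acts as `σ`, with `T ∩ G ≅ ℤ_p^{n-1}`. -/
def ProperIntersectionCase {n p : ℕ} (σ : GLnp n p) : Prop :=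
  ∃ (G : Type) (_ : Group G) (C : CayleyMap G) (T : Subgroup C.aut),
    IsElemAb p n G ∧ C.IsRegular ∧ C.ActsAs T σ ∧
      IsElemAb p (n - 1) (T ⊓ C.groupImage : Subgroup C.aut)

/-! A minimal polynomial `m` of degree `n` makes `𝔽_p^n` a cyclic `𝔽_p[x]`-module, isomorphic to
`𝔽_p[x]/(m)`. So `m` determines the conjugacy class, and every monic `m` of degree `n` with `m(0) ≠
0` occurs (`isConj_of_minPoly_eq`, `exists_minPoly_eq`). Moreover `-I ∈ ⟨σ⟩` means `m ∣ x^k + 1` for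
some `k`. For odd `p` an irreducible `g` divides `x^k + 1` exactly when `ord g` divides `2k` but not
`k`, which forces `[ord g]_2 = [k]_2 + 1`. Hence all irreducible factors of `m` share one value `j`;
conversely, a common `j` permits a common `k`. This is (1).

For (2), put `o = o(σ)` and `N = σ^{o/p} - 1 ≠ 0`. On a cyclic module `N` vanishes on a hyperplane
iff `(σ - a)N = 0` for some scalar `a`, that is, `m ∣ (x - a)(x^{o/p} - 1)`
(`fixesHyperplane_iff_exists_dvd`). If `o = L p^{d+1}` with `p ∤ L`, then `x^{o/p} - 1 = (x^L -
1)^{p^d}` with `x^L - 1` squarefree, and comparing multiplicities gives the condition on exponents.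

For (3), an automorphism fixing a dart is trivial, so every automorphism is a translation in `T`
times a power of the local rotation `r`. The connection set corresponds to one `σ`-orbit, closed
under negation and generating `𝔽_p^n`, whence `HasMType`. If `H` is as in (3), an element `t_u r^i`
of `H` outside `T` commutes with `T ∩ H`, so `σ^i` has order `p` and fixes a hyperplane; `p = 2`
would put `r^i` itself into `H`. Conversely write `σ^{o/p} = 1 + l(·)w`, where `l(w) = 0`, and `ψ =
r^{o/p}`. For odd `p` the map `v ↦ t(v + l(v)²/2 · w) ψ^{l(v)}` is an injective homomorphism whose
image is vertex-regular and meets `T` in `t(ker l)` (`TranslationModel.exists_vertexRegular`).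

For existence, the orbit of a cyclic vector is the connection set of a Cayley map with `T = G`.
Relabelling its vertices by `H` turns `H` into the new group `G` (`transfer`). -/

/-! ### Cyclic modules over the polynomial ring -/

namespace Module.End

variable {K V : Type*} [Field K] [AddCommGroup V] [Module K V]

/-- If `minpoly = r^(k+1) c` and `w` is not killed by `r^k c`, then `c(f) w` is killed by `r^(k+1)`
but not by `r^k`, so its annihilator is generated by `r^(k+1)`. For coprime factors the two vectors
are added. -/
theorem exists_annihilator_eq_of_dvd_minpoly [FiniteDimensional K V] (f : Module.End K V)
    (d : K[X]) (hd : d ∣ minpoly K f) : ∃ v : V, ∀ q : K[X], aeval f q v = 0 ↔ d ∣ q := by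
  have hm0 : minpoly K f ≠ 0 := minpoly.ne_zero (Algebra.IsIntegral.isIntegral f)
  induction d using UniqueFactorizationMonoid.induction_on_coprime with
  | h0 => exact absurd (zero_dvd_iff.1 hd) hm0
  | h1 hu => exact ⟨0, fun q => by simp [hu.dvd]⟩
  | @hpr r i hr =>
    rcases Nat.eq_zero_or_pos i with rfl | hi
    · exact ⟨0, fun q => by simp⟩
    obtain ⟨c, hc⟩ := hd
    obtain ⟨k, rfl⟩ : ∃ k, i = k + 1 := ⟨i - 1, by omega⟩
    have hne : aeval f (r ^ k * c) ≠ 0 := by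
      intro h0
      have h1 := minpoly.dvd K f h0
      rw [hc, pow_succ] at h1
      have h2 : r ^ k * c ≠ 0 := by
        rintro h
        apply hm0
        rw [hc, pow_succ, mul_right_comm, h, zero_mul]
      have h3 : (r ^ k * c) * r ∣ (r ^ k * c) * 1 := by
        rw [mul_one]; convert h1 using 1; ring
      exact hr.not_isUnit (isUnit_of_dvd_one ((mul_dvd_mul_iff_left h2).1 h3))
    obtain ⟨w, hw⟩ : ∃ w, aeval f (r ^ k * c) w ≠ 0 := by
      by_contra! h
      exact hne (LinearMap.ext h)
    have hkill : aeval f (r ^ (k + 1)) (aeval f c w) = 0 := by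
      rw [← Module.End.mul_apply, ← map_mul, ← hc, minpoly.aeval, LinearMap.zero_apply]
    refine ⟨aeval f c w, fun q => ⟨fun hq => ?_, ?_⟩⟩
    · classical
      obtain ⟨j, hj, hass⟩ := (dvd_prime_pow hr _).1 (EuclideanDomain.gcd_dvd_right q (r ^ (k + 1)))
      have hg : aeval f (EuclideanDomain.gcd q (r ^ (k + 1))) (aeval f c w) = 0 := by
        rw [EuclideanDomain.gcd_eq_gcd_ab, map_add, LinearMap.add_apply, mul_comm q,
          mul_comm (r ^ (k + 1)), map_mul, map_mul, Module.End.mul_apply, Module.End.mul_apply, hq,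
          hkill, map_zero, map_zero, add_zero]
      rcases Nat.lt_or_ge j (k + 1) with hlt | hge
      · exfalso
        obtain ⟨s, hs⟩ : EuclideanDomain.gcd q (r ^ (k + 1)) ∣ r ^ k :=
          hass.dvd.trans (pow_dvd_pow r (by omega))
        apply hw
        rw [map_mul, Module.End.mul_apply, hs, mul_comm, map_mul, Module.End.mul_apply, hg, map_zero]
      · obtain rfl : j = k + 1 := le_antisymm hj hge
        exact hass.symm.dvd.trans (EuclideanDomain.gcd_dvd_left _ _)
    · rintro ⟨s, rfl⟩
      rw [mul_comm, map_mul, Module.End.mul_apply, hkill, map_zero]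
  | @hcp x y hxy hx hy =>
    obtain ⟨v, hv⟩ := hx ((dvd_mul_right _ _).trans hd)
    obtain ⟨w, hw⟩ := hy ((dvd_mul_left _ _).trans hd)
    refine ⟨v + w, fun q => ⟨fun hq => ?_, fun hq => ?_⟩⟩
    · refine hxy.mul_dvd ?_ ?_
      · refine hxy.dvd_of_dvd_mul_left ((hv _).1 ?_)
        have h1 := congrArg (aeval f y) hq
        have h2 : aeval f y (aeval f q w) = 0 := by
          rw [← Module.End.mul_apply, ← map_mul, hw]; exact dvd_mul_right _ _
        rw [map_add, map_add, h2, map_zero, add_zero] at h1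
        rw [map_mul, Module.End.mul_apply, h1]
      · refine hxy.symm.dvd_of_dvd_mul_left ((hw _).1 ?_)
        have h1 := congrArg (aeval f x) hq
        have h2 : aeval f x (aeval f q v) = 0 := by
          rw [← Module.End.mul_apply, ← map_mul, hv]; exact dvd_mul_right _ _
        rw [map_add, map_add, h2, map_zero, zero_add] at h1
        rw [map_mul, Module.End.mul_apply, h1]
    · rw [map_add, (hv q).2 ((dvd_mul_right _ _).trans hq),
        (hw q).2 ((dvd_mul_left _ _).trans hq), add_zero]

/-- The orbit map of `v`, on the quotient of the polynomial ring by the minimal polynomial. -/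
noncomputable def orbitMap (f : Module.End K V) (m : K[X]) (hm : minpoly K f = m) (v : V) :
    AdjoinRoot m →ₗ[K] V :=
  (LinearMap.applyₗ v : (V →ₗ[K] V) →ₗ[K] V) ∘ₗ
    (Ideal.Quotient.liftₐ (Ideal.span {m}) (aeval f : K[X] →ₐ[K] Module.End K V) (by
      intro a ha
      obtain ⟨c, rfl⟩ := Ideal.mem_span_singleton.1 ha
      rw [← hm, map_mul, minpoly.aeval, zero_mul])).toLinearMap

theorem orbitMap_mk (f : Module.End K V) (m : K[X]) (hm : minpoly K f = m) (v : V) (q : K[X]) :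
    orbitMap f m hm v (AdjoinRoot.mk m q) = aeval f q v := rfl

/-- A vector whose annihilator is exactly `(m)` has an injective orbit map, and the dimensions
agree. -/
theorem exists_adjoinRoot_equiv [FiniteDimensional K V] (f : Module.End K V) (m : K[X])
    (hm : minpoly K f = m) (hd : m.natDegree = Module.finrank K V) :
    ∃ e : AdjoinRoot m ≃ₗ[K] V, ∀ q, e (AdjoinRoot.mk m q) = aeval f q (e 1) := by
  have hm0 : m ≠ 0 := hm ▸ minpoly.ne_zero (Algebra.IsIntegral.isIntegral f)
  obtain ⟨v, hv⟩ := exists_annihilator_eq_of_dvd_minpoly f m (hm ▸ dvd_rfl)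
  have hfr : Module.finrank K (AdjoinRoot m) = Module.finrank K V := by
    rw [(AdjoinRoot.powerBasis hm0).finrank, AdjoinRoot.powerBasis_dim, hd]
  have : FiniteDimensional K (AdjoinRoot m) := (AdjoinRoot.powerBasis hm0).finite
  have hinj : Function.Injective (orbitMap f m hm v) := by
    rw [injective_iff_map_eq_zero]
    intro a ha
    obtain ⟨q, rfl⟩ := AdjoinRoot.mk_surjective a
    rw [orbitMap_mk, hv] at ha
    exact AdjoinRoot.mk_eq_zero.2 ha
  refine ⟨LinearEquiv.ofInjectiveOfFinrankEq _ hinj hfr, fun q => ?_⟩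
  have h1 : orbitMap f m hm v 1 = v := by
    rw [← map_one (AdjoinRoot.mk m), orbitMap_mk, map_one, Module.End.one_apply]
  change orbitMap f m hm v _ = aeval f q (orbitMap f m hm v 1)
  rw [h1, orbitMap_mk]

theorem exists_cyclic_vector [FiniteDimensional K V] (f : Module.End K V)
    (hd : (minpoly K f).natDegree = Module.finrank K V) :
    ∃ v : V, ∀ w, ∃ q : K[X], aeval f q v = w := by
  obtain ⟨e, he⟩ := exists_adjoinRoot_equiv f _ rfl hd
  refine ⟨e 1, fun w => ?_⟩
  obtain ⟨q, hq⟩ := AdjoinRoot.mk_surjective (e.symm w)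
  exact ⟨q, by rw [← he, hq, e.apply_symm_apply]⟩

/-- Cayley–Hamilton bounds the degree above; surjectivity of the orbit map of `v` bounds it below.
-/
theorem natDegree_minpoly_of_cyclic [FiniteDimensional K V] (f : Module.End K V) (v : V)
    (hv : ∀ w, ∃ q : K[X], aeval f q v = w) :
    (minpoly K f).natDegree = Module.finrank K V := by
  have hm0 : minpoly K f ≠ 0 := minpoly.ne_zero (Algebra.IsIntegral.isIntegral f)
  apply le_antisymm
  · rw [← LinearMap.charpoly_natDegree f]
    exact natDegree_le_of_dvd (LinearMap.minpoly_dvd_charpoly f) (LinearMap.charpoly_monic f).ne_zero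
  · have : FiniteDimensional K (AdjoinRoot (minpoly K f)) := (AdjoinRoot.powerBasis hm0).finite
    rw [← AdjoinRoot.powerBasis_dim hm0, ← (AdjoinRoot.powerBasis hm0).finrank]
    refine LinearMap.finrank_le_finrank_of_surjective (f := orbitMap f _ rfl v) fun w => ?_
    obtain ⟨q, hq⟩ := hv w
    exact ⟨AdjoinRoot.mk _ q, hq⟩

/-- Both endomorphisms are multiplication by `X` on the same quotient of `K[X]`. -/
theorem exists_equiv_of_minpoly_eq [FiniteDimensional K V] (f g : Module.End K V)
    (hd : (minpoly K f).natDegree = Module.finrank K V) (hfg : minpoly K f = minpoly K g) :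
    ∃ c : V ≃ₗ[K] V, ∀ v, c (f v) = g (c v) := by
  obtain ⟨e, he⟩ := exists_adjoinRoot_equiv f _ rfl hd
  obtain ⟨e', he'⟩ := exists_adjoinRoot_equiv g _ hfg.symm hd
  refine ⟨e.symm.trans e', fun v => ?_⟩
  obtain ⟨q, hq⟩ := AdjoinRoot.mk_surjective (e.symm v)
  obtain rfl : v = aeval f q (e 1) := by rw [← he, hq, e.apply_symm_apply]
  have h1 : f (aeval f q (e 1)) = aeval f (X * q) (e 1) := by
    rw [map_mul, aeval_X, Module.End.mul_apply]
  rw [h1, ← he, ← he, LinearEquiv.trans_apply, LinearEquiv.trans_apply, e.symm_apply_apply,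
    e.symm_apply_apply, he', he', map_mul, aeval_X, Module.End.mul_apply]

end Module.End

/-! ### Conjugacy classes and minimal polynomials -/

section LinearGroup

variable {n p : ℕ} [Fact p.Prime]

theorem finrank_fin_fun_zmod : Module.finrank (ZMod p) (Fin n → ZMod p) = n := by simp

theorem finite_GLnp : Finite (GLnp n p) := by
  have : Finite (Module.End (ZMod p) (Fin n → ZMod p)) :=
    Finite.of_injective (fun f => (f : (Fin n → ZMod p) → (Fin n → ZMod p)))
      DFunLike.coe_injective
  exact Finite.of_injective (fun u : GLnp n p => (u : Module.End (ZMod p) (Fin n → ZMod p)))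
    Units.val_injective

theorem aeval_eq_zero_iff_minPoly_dvd (σ : GLnp n p) (q : (ZMod p)[X]) :
    aeval (σ : Module.End (ZMod p) (Fin n → ZMod p)) q = 0 ↔ minPoly σ ∣ q :=
  (minpoly.dvd_iff (A := ZMod p)).symm

theorem minPoly_monic (σ : GLnp n p) : (minPoly σ).Monic :=
  minpoly.monic (Algebra.IsIntegral.isIntegral _)

theorem minPoly_eq_of_isConj {σ τ : GLnp n p} (h : IsConj σ τ) : minPoly σ = minPoly τ := by
  obtain ⟨c, hc⟩ := isConj_iff.1 h
  let e := LinearMap.GeneralLinearGroup.generalLinearEquiv (ZMod p) (Fin n → ZMod p) c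
  have h1 := minpoly.algEquiv_eq (e.conjAlgEquiv (ZMod p))
    (σ : Module.End (ZMod p) (Fin n → ZMod p))
  have h2 : e.conjAlgEquiv (ZMod p) (σ : Module.End (ZMod p) (Fin n → ZMod p)) =
      (τ : Module.End (ZMod p) (Fin n → ZMod p)) := by
    rw [← hc]; rfl
  rw [minPoly, minPoly, ← h1, h2]

theorem isConj_of_minPoly_eq {σ τ : GLnp n p} (hd : (minPoly σ).natDegree = n)
    (h : minPoly σ = minPoly τ) : IsConj σ τ := by
  obtain ⟨c, hc⟩ := Module.End.exists_equiv_of_minpoly_eq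
    (σ : Module.End (ZMod p) (Fin n → ZMod p)) τ (by rw [finrank_fin_fun_zmod]; exact hd) h
  refine isConj_iff.2 ⟨LinearMap.GeneralLinearGroup.ofLinearEquiv c, ?_⟩
  rw [mul_inv_eq_iff_eq_mul]
  exact Units.ext (LinearMap.ext hc)

/-- The transformation is multiplication by the root on `AdjoinRoot f`; it is invertible because `X`
and `f` are coprime. -/
theorem exists_minPoly_eq (f : (ZMod p)[X]) (hf : f.Monic) (hd : f.natDegree = n)
    (h0 : f.eval 0 ≠ 0) : ∃ σ : GLnp n p, minPoly σ = f := by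
  have hfr : Module.finrank (ZMod p) (AdjoinRoot f) =
      Module.finrank (ZMod p) (Fin n → ZMod p) := by
    rw [(AdjoinRoot.powerBasis hf.ne_zero).finrank, AdjoinRoot.powerBasis_dim, hd,
      finrank_fin_fun_zmod]
  have : FiniteDimensional (ZMod p) (AdjoinRoot f) := (AdjoinRoot.powerBasis hf.ne_zero).finite
  have hu : IsUnit (AdjoinRoot.root f) := by
    have hcop : IsCoprime (X : (ZMod p)[X]) f := by
      rw [(irreducible_X (R := ZMod p)).coprime_iff_not_dvd, X_dvd_iff, coeff_zero_eq_eval_zero]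
      exact h0
    obtain ⟨a, b, hab⟩ := hcop
    have h1 := congrArg (AdjoinRoot.mk f) hab
    rw [map_add, map_mul, map_mul, AdjoinRoot.mk_self, mul_zero, add_zero, map_one,
      AdjoinRoot.mk_X] at h1
    exact IsUnit.of_mul_eq_one _ (by rw [mul_comm]; exact h1)
  let e := LinearEquiv.ofFinrankEq (AdjoinRoot f) (Fin n → ZMod p) hfr
  let φ : AdjoinRoot f →ₐ[ZMod p] Module.End (ZMod p) (Fin n → ZMod p) :=
    (e.conjAlgEquiv (ZMod p)).toAlgHom.comp (Algebra.lmul (ZMod p) (AdjoinRoot f))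
  have hφ : Function.Injective φ :=
    (e.conjAlgEquiv (ZMod p)).injective.comp Algebra.lmul_injective
  refine ⟨Units.map (φ : AdjoinRoot f →* _) hu.unit, ?_⟩
  have h1 := minpoly.algHom_eq φ hφ (AdjoinRoot.root f)
  rw [AdjoinRoot.minpoly_root hf.ne_zero, hf.leadingCoeff, inv_one, C_1, mul_one] at h1
  exact h1

end LinearGroup

/-! ### Orders of irreducible polynomials -/

section PolyOrd

variable {p : ℕ} [Fact p.Prime]

theorem dvd_X_pow_sub_one_iff_root (g : (ZMod p)[X]) (e : ℕ) :
    g ∣ X ^ e - 1 ↔ AdjoinRoot.root g ^ e = 1 := by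
  rw [← AdjoinRoot.mk_eq_zero, map_sub, map_pow, map_one, AdjoinRoot.mk_X, sub_eq_zero]

theorem dvd_X_pow_card_sub_one {g : (ZMod p)[X]} (hg : Irreducible g) (h0 : g.eval 0 ≠ 0) :
    g ∣ X ^ (p ^ g.natDegree - 1) - 1 := by
  have := Fact.mk hg
  have hfin : Module.Finite (ZMod p) (AdjoinRoot g) := (AdjoinRoot.powerBasis hg.ne_zero).finite
  have : Finite (AdjoinRoot g) := Module.finite_of_finite (ZMod p)
  have := Fintype.ofFinite (AdjoinRoot g)
  rw [dvd_X_pow_sub_one_iff_root]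
  have hcard : Fintype.card (AdjoinRoot g) = p ^ g.natDegree := by
    rw [Module.card_eq_pow_finrank (K := ZMod p), ZMod.card,
      (AdjoinRoot.powerBasis hg.ne_zero).finrank, AdjoinRoot.powerBasis_dim]
  rw [← hcard]
  apply FiniteField.pow_card_sub_one_eq_one
  intro h
  rw [← AdjoinRoot.mk_X, AdjoinRoot.mk_eq_zero] at h
  have hass := (hg.dvd_symm irreducible_X h)
  rw [X_dvd_iff, coeff_zero_eq_eval_zero] at hass
  exact h0 hass

theorem pow_natDegree_sub_one_pos {g : (ZMod p)[X]} (hg : Irreducible g) :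
    0 < p ^ g.natDegree - 1 :=
  Nat.sub_pos_of_lt (Nat.one_lt_pow hg.natDegree_pos.ne' (Fact.out : p.Prime).one_lt)

/-- The exponent `p^deg g - 1` shows that the set defining `polyOrd` is nonempty, so its infimum is
not the default value `0`. -/
theorem polyOrd_eq_orderOf_root {g : (ZMod p)[X]} (hg : Irreducible g) (h0 : g.eval 0 ≠ 0) :
    polyOrd g = orderOf (AdjoinRoot.root g) := by
  have hfin : IsOfFinOrder (AdjoinRoot.root g) := isOfFinOrder_iff_pow_eq_one.2
    ⟨_, pow_natDegree_sub_one_pos hg,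
      (dvd_X_pow_sub_one_iff_root g _).1 (dvd_X_pow_card_sub_one hg h0)⟩
  apply le_antisymm
  · exact Nat.sInf_le ⟨hfin.orderOf_pos, (dvd_X_pow_sub_one_iff_root g _).2 (pow_orderOf_eq_one _)⟩
  · obtain ⟨h1, h2⟩ : polyOrd g ∈ {e : ℕ | 1 ≤ e ∧ g ∣ X ^ e - 1} :=
      Nat.sInf_mem ⟨_, pow_natDegree_sub_one_pos hg, dvd_X_pow_card_sub_one hg h0⟩
    exact orderOf_le_of_pow_eq_one h1 ((dvd_X_pow_sub_one_iff_root g _).1 h2)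

theorem dvd_X_pow_sub_one_iff {g : (ZMod p)[X]} (hg : Irreducible g) (h0 : g.eval 0 ≠ 0) (e : ℕ) :
    g ∣ X ^ e - 1 ↔ polyOrd g ∣ e := by
  rw [polyOrd_eq_orderOf_root hg h0, dvd_X_pow_sub_one_iff_root, orderOf_dvd_iff_pow_eq_one]

theorem polyOrd_dvd_pow_sub_one {g : (ZMod p)[X]} (hg : Irreducible g) (h0 : g.eval 0 ≠ 0) :
    polyOrd g ∣ p ^ g.natDegree - 1 :=
  (dvd_X_pow_sub_one_iff hg h0 _).1 (dvd_X_pow_card_sub_one hg h0)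

theorem polyOrd_ne_zero {g : (ZMod p)[X]} (hg : Irreducible g) (h0 : g.eval 0 ≠ 0) :
    polyOrd g ≠ 0 :=
  ne_zero_of_dvd_ne_zero (pow_natDegree_sub_one_pos hg).ne' (polyOrd_dvd_pow_sub_one hg h0)

theorem isUnit_two_polynomial (hp : p ≠ 2) : IsUnit (2 : (ZMod p)[X]) := by
  have h2 : (2 : ZMod p) ≠ 0 := by
    intro h
    have h3 := (ZMod.natCast_eq_zero_iff 2 p).1 (by exact_mod_cast h)
    exact hp ((Nat.prime_dvd_prime_iff_eq Fact.out Nat.prime_two).1 h3)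
  have := (isUnit_iff_ne_zero.2 h2).map (C : ZMod p →+* (ZMod p)[X])
  simpa only [map_ofNat] using this

/-- In `X^(2m) - 1 = (X^m - 1)(X^m + 1)` the two factors differ by the unit `2`, so `g` cannot
divide both. -/
theorem dvd_X_pow_add_one_iff (hp : p ≠ 2) {g : (ZMod p)[X]} (hg : Irreducible g)
    (h0 : g.eval 0 ≠ 0) (m : ℕ) :
    g ∣ X ^ m + 1 ↔ polyOrd g ∣ 2 * m ∧ ¬ polyOrd g ∣ m := by
  have hfac : (X ^ (2 * m) - 1 : (ZMod p)[X]) = (X ^ m - 1) * (X ^ m + 1) := by ring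
  rw [← dvd_X_pow_sub_one_iff hg h0, ← dvd_X_pow_sub_one_iff hg h0, hfac]
  constructor
  · refine fun h => ⟨h.mul_left _, fun h' => hg.not_isUnit ?_⟩
    have h2 : g ∣ 2 := by
      have := dvd_sub h h'
      ring_nf at this
      exact this
    exact isUnit_of_dvd_unit h2 (isUnit_two_polynomial hp)
  · rintro ⟨h1, h2⟩
    exact (hg.prime.dvd_or_dvd h1).resolve_left h2

/-- The odd part of `o` always divides `m`, so only an excess in the power of `2` can prevent `o ∣
m`. -/
theorem padicValNat_two_eq_of_dvd_two_mul {o m : ℕ} (hm : m ≠ 0) (h1 : o ∣ 2 * m) (h2 : ¬ o ∣ m) :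
    padicValNat 2 o = padicValNat 2 m + 1 := by
  have ho : o ≠ 0 := ne_zero_of_dvd_ne_zero (by omega) h1
  have hle : padicValNat 2 o ≤ padicValNat 2 m + 1 := by
    have h3 : padicValNat 2 (2 * m) = padicValNat 2 m + 1 := by
      rw [padicValNat.mul (by norm_num) hm, padicValNat.self (by norm_num), add_comm]
    rw [← h3, ← padicValNat_dvd_iff_le (by omega)]
    exact pow_padicValNat_dvd.trans h1
  refine le_antisymm hle ?_
  by_contra! hlt
  apply h2
  obtain ⟨b, hb⟩ := (pow_padicValNat_dvd : 2 ^ padicValNat 2 o ∣ o)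
  have hodd : ¬ 2 ∣ b := by
    rintro ⟨c, rfl⟩
    exact pow_succ_padicValNat_not_dvd (p := 2) ho ⟨c, by rw [pow_succ]; linarith⟩
  have hcop : Nat.Coprime 2 b := (Nat.prime_two.coprime_iff_not_dvd).2 hodd
  rw [hb]
  refine Nat.Coprime.mul_dvd_of_dvd_of_dvd (hcop.pow_left _) ?_ ?_
  · exact (padicValNat_dvd_iff_le hm).2 (by omega)
  · exact hcop.symm.dvd_of_dvd_mul_left ((Dvd.intro_left _ hb.symm).trans h1)

end PolyOrd

/-! ### Factorizations and the condition `-I ∈ ⟨σ⟩` -/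

section Factorization

variable {n p : ℕ} [Fact p.Prime]

/-- The union of the sets `A_{ij}` for `1 ≤ i ≤ n`. -/
noncomputable def allA (n p j : ℕ) [Fact p.Prime] : Finset (ZMod p)[X] :=
  (Finset.Icc 1 n).biUnion fun i => finA p i j

theorem mem_finA {i j : ℕ} {g : (ZMod p)[X]} : g ∈ finA p i j ↔ g ∈ setA p i j :=
  Set.Finite.mem_toFinset _

/-- The condition `2^j ∣ p^i - 1` disappears: it follows from `ord g ∣ p^i - 1`. -/
theorem mem_allA {j : ℕ} {g : (ZMod p)[X]} : g ∈ allA n p j ↔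
    1 ≤ j ∧ g.natDegree ≤ n ∧ g.Monic ∧ Irreducible g ∧ g.eval 0 ≠ 0 ∧
      padicValNat 2 (polyOrd g) = j := by
  simp only [allA, Finset.mem_biUnion, mem_finA, Finset.mem_Icc, setA, Set.mem_ofPred_eq]
  constructor
  · rintro ⟨i, ⟨hi1, hin⟩, hj, -, hm, rfl, hirr, h0, hv⟩
    exact ⟨hj, hin, hm, hirr, h0, hv⟩
  · rintro ⟨hj, hin, hm, hirr, h0, hv⟩
    refine ⟨_, ⟨hirr.natDegree_pos, hin⟩, hj, ?_, hm, rfl, hirr, h0, hv⟩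
    rw [← hv]
    exact pow_padicValNat_dvd.trans (polyOrd_dvd_pow_sub_one hirr h0)

theorem finA_pairwiseDisjoint (s : Set ℕ) (j : ℕ) :
    s.PairwiseDisjoint fun i => finA p i j := by
  intro a _ b _ hab
  refine Finset.disjoint_left.2 fun g hg hg' => hab ?_
  rw [← (mem_finA.1 hg).2.2.2.1, ← (mem_finA.1 hg').2.2.2.1]

theorem isFactorization_iff {j : ℕ} {k : (ZMod p)[X] → ℕ} {f : (ZMod p)[X]} :
    IsFactorization n p j k f ↔
      f = ∏ g ∈ allA n p j, g ^ k g ∧ ∑ g ∈ allA n p j, k g * g.natDegree = n := by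
  have h1 : ∏ g ∈ allA n p j, g ^ k g = ∏ i ∈ Finset.Icc 1 n, ∏ g ∈ finA p i j, g ^ k g :=
    Finset.prod_biUnion (finA_pairwiseDisjoint _ _)
  have h2 : ∑ g ∈ allA n p j, k g * g.natDegree =
      ∑ i ∈ Finset.Icc 1 n, ∑ g ∈ finA p i j, k g * i := by
    refine (Finset.sum_biUnion (finA_pairwiseDisjoint _ _)).trans ?_
    refine Finset.sum_congr rfl fun i _ => Finset.sum_congr rfl fun g hg => ?_
    rw [(mem_finA.1 hg).2.2.2.1]
  rw [IsFactorization, h1, h2]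

theorem isCoprime_of_irreducible_monic_ne {F : Type*} [Field F] {g h : F[X]} (hg : Irreducible g)
    (hh : Irreducible h) (hgm : g.Monic) (hhm : h.Monic) (hne : g ≠ h) : IsCoprime g h :=
  hg.coprime_iff_not_dvd.2 fun hd =>
    hne (eq_of_monic_of_associated hgm hhm (hg.associated_of_dvd hh hd))

theorem allA_pairwise_isCoprime (j : ℕ) (k : (ZMod p)[X] → ℕ) :
    (allA n p j : Set (ZMod p)[X]).Pairwise (Function.onFun IsCoprime fun g => g ^ k g) := by
  intro g hg h hh hne
  obtain ⟨-, -, hgm, hgi, -⟩ := mem_allA.1 (Finset.mem_coe.1 hg)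
  obtain ⟨-, -, hhm, hhi, -⟩ := mem_allA.1 (Finset.mem_coe.1 hh)
  exact (isCoprime_of_irreducible_monic_ne hgi hhi hgm hhm hne).pow

namespace IsFactorization

variable {j : ℕ} {k : (ZMod p)[X] → ℕ} {f : (ZMod p)[X]}

theorem monic (h : IsFactorization n p j k f) : f.Monic := by
  rw [(isFactorization_iff.1 h).1]
  exact monic_prod_of_monic _ _ fun g hg => (mem_allA.1 hg).2.2.1.pow _

theorem natDegree_eq (h : IsFactorization n p j k f) : f.natDegree = n := by
  obtain ⟨h1, h2⟩ := isFactorization_iff.1 h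
  rw [h1, natDegree_prod_of_monic _ _ fun g hg => (mem_allA.1 hg).2.2.1.pow _]
  refine Eq.trans (Finset.sum_congr rfl fun g hg => ?_) h2
  rw [(mem_allA.1 hg).2.2.1.natDegree_pow]

theorem eval_zero_ne_zero (h : IsFactorization n p j k f) : f.eval 0 ≠ 0 := by
  rw [(isFactorization_iff.1 h).1, eval_prod, Finset.prod_ne_zero_iff]
  intro g hg
  rw [eval_pow]
  exact pow_ne_zero _ (mem_allA.1 hg).2.2.2.2.1

theorem pow_dvd (h : IsFactorization n p j k f) {g : (ZMod p)[X]} (hg : g ∈ allA n p j) :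
    g ^ k g ∣ f := by
  rw [(isFactorization_iff.1 h).1]
  exact Finset.dvd_prod_of_mem _ hg

theorem dvd_of_forall_pow_dvd (h : IsFactorization n p j k f) {q : (ZMod p)[X]}
    (hq : ∀ g ∈ allA n p j, g ^ k g ∣ q) : f ∣ q := by
  rw [(isFactorization_iff.1 h).1]
  exact Finset.prod_dvd_of_coprime (allA_pairwise_isCoprime j k) hq

/-- Take `2^(j-1)` times the product of the odd parts of the orders, so that each `g` divides `X^m +
1` once. Then multiply the exponent by a power of `p`: by Frobenius this raises `X^m + 1` to that
power and absorbs the multiplicities. -/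
theorem exists_dvd_X_pow_add_one (hp : p ≠ 2) (h : IsFactorization n p j k f) :
    ∃ m, f ∣ X ^ m + 1 := by
  rcases Nat.eq_zero_or_pos j with rfl | hj
  -- There are no admissible factors for `j = 0`, so any exponent works.
  · refine ⟨0, h.dvd_of_forall_pow_dvd fun g hg => ?_⟩
    exact absurd (mem_allA.1 hg).1 (by norm_num)
  obtain ⟨i, rfl⟩ : ∃ i, j = i + 1 := ⟨j - 1, by omega⟩
  have hval : ∀ g ∈ allA n p (i + 1), ∃ b, polyOrd g = 2 ^ (i + 1) * b ∧ ¬ 2 ∣ b := by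
    intro g hg
    obtain ⟨-, -, -, hirr, h0, hv⟩ := mem_allA.1 hg
    obtain ⟨b, hb⟩ := (pow_padicValNat_dvd : 2 ^ padicValNat 2 (polyOrd g) ∣ polyOrd g)
    rw [hv] at hb
    refine ⟨b, hb, ?_⟩
    rintro ⟨c, rfl⟩
    apply pow_succ_padicValNat_not_dvd (p := 2) (polyOrd_ne_zero hirr h0)
    rw [hv]
    exact ⟨c, by rw [pow_succ]; linarith⟩
  choose! b hb hodd using hval
  set P := ∏ g ∈ allA n p (i + 1), b g with hP
  have hPodd : ¬ 2 ∣ P := by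
    rw [Nat.prime_two.prime.dvd_finsetProd_iff]
    rintro ⟨g, hg, hd⟩
    exact hodd g hg hd
  have hdvd : ∀ g ∈ allA n p (i + 1), g ∣ X ^ (2 ^ i * P) + 1 := by
    intro g hg
    obtain ⟨-, -, -, hirr, h0, hv⟩ := mem_allA.1 hg
    rw [dvd_X_pow_add_one_iff hp hirr h0, hb g hg]
    constructor
    · rw [← mul_assoc, ← pow_succ']
      exact mul_dvd_mul_left _ (Finset.dvd_prod_of_mem _ hg)
    · intro hd
      rw [pow_succ, mul_assoc] at hd
      exact hPodd ((dvd_mul_right _ _).trans (Nat.dvd_of_mul_dvd_mul_left (by positivity) hd))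
  -- The sum is merely a common bound for the multiplicities, and `t < p^t`.
  set t := ∑ g ∈ allA n p (i + 1), k g
  refine ⟨(2 ^ i * P) * p ^ t, h.dvd_of_forall_pow_dvd fun g hg => ?_⟩
  have h1 : (X ^ (2 ^ i * P * p ^ t) + 1 : (ZMod p)[X]) = (X ^ (2 ^ i * P) + 1) ^ p ^ t := by
    rw [add_pow_char_pow, one_pow, ← pow_mul]
  rw [h1]
  refine (pow_dvd_pow g ?_).trans (pow_dvd_pow_of_dvd (hdvd g hg) _)
  exact (Finset.single_le_sum (f := k) (fun _ _ => Nat.zero_le _) hg).trans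
    (Nat.lt_pow_self (Fact.out : p.Prime).one_lt).le

end IsFactorization

/-- Every irreducible factor of `X^m + 1` has an order of 2-adic valuation `[m]_2 + 1`; this is the
common `j`. An irreducible factor of `f`, of degree at most `n`, bounds `j` by `dMax n p`. -/
theorem exists_isFactorization (hp : p ≠ 2) (hn : 1 ≤ n) {f : (ZMod p)[X]} (hf : f.Monic)
    (hd : f.natDegree = n) {m : ℕ} (hm : f ∣ X ^ m + 1) :
    ∃ j ∈ Finset.Icc 1 (dMax n p), ∃ k : (ZMod p)[X] → ℕ, IsFactorization n p j k f := by
  classical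
  have hfu : ¬ IsUnit f := fun hu => by
    rw [hf.isUnit_iff] at hu
    rw [hu, natDegree_one] at hd
    omega
  have hm0 : m ≠ 0 := by
    rintro rfl
    apply hfu
    rw [pow_zero, one_add_one_eq_two] at hm
    exact isUnit_of_dvd_unit hm (isUnit_two_polynomial hp)
  have hfac : ∀ g : (ZMod p)[X], Irreducible g → g ∣ f → g.eval 0 ≠ 0 ∧
      padicValNat 2 (polyOrd g) = padicValNat 2 m + 1 := by
    intro g hg hgf
    have hgm := hgf.trans hm
    have h0 : g.eval 0 ≠ 0 := by
      intro h0
      obtain ⟨c, hc⟩ := hgm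
      have := congrArg (eval 0) hc
      simp [h0, hm0] at this
    obtain ⟨h1, h2⟩ := (dvd_X_pow_add_one_iff hp hg h0 m).1 hgm
    exact ⟨h0, padicValNat_two_eq_of_dvd_two_mul hm0 h1 h2⟩
  have hsub : ∀ g ∈ UniqueFactorizationMonoid.normalizedFactors f,
      g ∈ allA n p (padicValNat 2 m + 1) := by
    intro g hg
    have hirr := UniqueFactorizationMonoid.irreducible_of_normalized_factor g hg
    have hgf := UniqueFactorizationMonoid.dvd_of_mem_normalizedFactors hg
    obtain ⟨h0, hv⟩ := hfac g hirr hgf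
    refine mem_allA.2 ⟨by omega, hd ▸ natDegree_le_of_dvd hgf hf.ne_zero, ?_, hirr, h0, hv⟩
    have := UniqueFactorizationMonoid.normalize_normalized_factor g hg
    rw [← this]
    exact monic_normalize hirr.ne_zero
  have hprod : f = ∏ g ∈ allA n p (padicValNat 2 m + 1),
      g ^ (UniqueFactorizationMonoid.normalizedFactors f).count g := by
    have h1 := UniqueFactorizationMonoid.prod_normalizedFactors_eq hf.ne_zero
    rw [hf.normalize_eq_self, Finset.prod_multiset_count] at h1
    conv_lhs => rw [← h1]
    refine Finset.prod_subset (fun g hg => hsub g (Multiset.mem_toFinset.1 hg)) fun g _ hg => ?_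
    rw [Multiset.count_eq_zero.2 (fun h => hg (Multiset.mem_toFinset.2 h)), pow_zero]
  refine ⟨padicValNat 2 m + 1, ?_, fun g => (UniqueFactorizationMonoid.normalizedFactors f).count g,
    isFactorization_iff.2 ⟨hprod, ?_⟩⟩
  · obtain ⟨g, hg, hgf⟩ := WfDvdMonoid.exists_irreducible_factor hfu hf.ne_zero
    obtain ⟨h0, hv⟩ := hfac g hg hgf
    rw [Finset.mem_Icc]
    refine ⟨by omega, ?_⟩
    have hle : padicValNat 2 (p ^ g.natDegree - 1) ≤ dMax n p :=
      Finset.le_sup (f := fun i => padicValNat 2 (p ^ i - 1))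
        (Finset.mem_Icc.2 ⟨hg.natDegree_pos, hd ▸ natDegree_le_of_dvd hgf hf.ne_zero⟩)
    refine le_trans ?_ hle
    rw [← hv, ← padicValNat_dvd_iff_le (pow_natDegree_sub_one_pos hg).ne']
    exact pow_padicValNat_dvd.trans (polyOrd_dvd_pow_sub_one hg h0)
  · have h2 := congrArg natDegree hprod
    rw [hd, natDegree_prod_of_monic _ _ fun g hg => (mem_allA.1 hg).2.2.1.pow _] at h2
    refine Eq.trans (Finset.sum_congr rfl fun g hg => ?_) h2.symm
    exact ((mem_allA.1 hg).2.2.1.natDegree_pow _).symm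

/-- Since the group is finite, nonnegative powers of `σ` suffice. -/
theorem neg_one_mem_zpowers_iff (σ : GLnp n p) :
    (-1 : GLnp n p) ∈ Subgroup.zpowers σ ↔ ∃ m, minPoly σ ∣ X ^ m + 1 := by
  have := finite_GLnp (n := n) (p := p)
  rw [← mem_powers_iff_mem_zpowers, Submonoid.mem_powers_iff]
  refine exists_congr fun m => ?_
  rw [← aeval_eq_zero_iff_minPoly_dvd, map_add, map_pow, aeval_X, map_one, ← Units.val_inj,
    Units.val_pow_eq_pow_val, Units.val_neg, Units.val_one, eq_neg_iff_add_eq_zero]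

theorem HasMType.of_isConj {σ τ : GLnp n p} (h : HasMType σ) (hc : IsConj σ τ) : HasMType τ := by
  have he := minPoly_eq_of_isConj hc
  exact ⟨he ▸ h.1, (neg_one_mem_zpowers_iff τ).2 (he ▸ (neg_one_mem_zpowers_iff σ).1 h.2)⟩

theorem HasMType.exists_isFactorization (hp : p ≠ 2) (hn : 1 ≤ n) {σ : GLnp n p}
    (h : HasMType σ) :
    ∃ j ∈ Finset.Icc 1 (dMax n p), ∃ k : (ZMod p)[X] → ℕ, IsFactorization n p j k (minPoly σ) := by
  obtain ⟨m, hm⟩ := (neg_one_mem_zpowers_iff σ).1 h.2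
  exact _root_.exists_isFactorization hp hn (minPoly_monic σ) h.1 hm

theorem image_minPoly_eq (hp : p ≠ 2) (hn : 1 ≤ n) {M : Set (GLnp n p)} (hM : IsBoldM M) :
    minPoly '' M =
      {f | ∃ j ∈ Finset.Icc 1 (dMax n p), ∃ k : (ZMod p)[X] → ℕ, IsFactorization n p j k f} := by
  ext f
  constructor
  · rintro ⟨σ, hσ, rfl⟩
    exact (hM.1 σ hσ).exists_isFactorization hp hn
  · rintro ⟨j, -, k, hk⟩
    obtain ⟨σ, hσ⟩ := exists_minPoly_eq f hk.monic hk.natDegree_eq hk.eval_zero_ne_zero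
    have hT : HasMType σ := ⟨hσ ▸ hk.natDegree_eq,
      (neg_one_mem_zpowers_iff σ).2 (hσ ▸ hk.exists_dvd_X_pow_add_one hp)⟩
    obtain ⟨τ, ⟨hτ, hc⟩, -⟩ := hM.2 σ hT
    exact ⟨τ, hτ, (minPoly_eq_of_isConj hc).symm.trans hσ⟩

end Factorization

/-! ### Endomorphisms of rank one -/

namespace Module.End

variable {K V : Type*} [Field K] [AddCommGroup V] [Module K V] [FiniteDimensional K V]

/-- A nonzero endomorphism that vanishes on a hyperplane has rank one. -/
theorem exists_functional_of_hyperplane (N : Module.End K V) (W : Submodule K V)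
    (hW : Module.finrank K W + 1 = Module.finrank K V) (h : ∀ w ∈ W, N w = 0) (hN : N ≠ 0) :
    ∃ (l : V →ₗ[K] K) (w₁ : V), w₁ ≠ 0 ∧ (∀ v, N v = l v • w₁) ∧ ∀ v, l v = 0 ↔ v ∈ W := by
  have hle : W ≤ LinearMap.ker N := fun w hw => LinearMap.mem_ker.2 (h w hw)
  have hlt : Module.finrank K (LinearMap.ker N) < Module.finrank K V := by
    apply Submodule.finrank_lt
    rwa [Ne, LinearMap.ker_eq_top]
  have hge := Submodule.finrank_mono hle
  have hrn := LinearMap.finrank_range_add_finrank_ker N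
  have hker : W = LinearMap.ker N := Submodule.eq_of_le_of_finrank_eq hle (by omega)
  have hr : Module.finrank K (LinearMap.range N) = Module.finrank K K := by
    rw [Module.finrank_self]; omega
  let e : LinearMap.range N ≃ₗ[K] K := LinearEquiv.ofFinrankEq _ _ hr
  let l : V →ₗ[K] K := e.toLinearMap ∘ₗ N.rangeRestrict
  have hNe : ∀ v, N v = l v • (e.symm 1 : V) := by
    intro v
    rw [← Submodule.coe_smul, ← map_smul, smul_eq_mul, mul_one]
    simp [l]
  refine ⟨l, e.symm 1, ?_, hNe, fun v => ?_⟩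
  · simp
  · rw [hker, LinearMap.mem_ker]
    simp [l, Subtype.ext_iff]

/-- The image of `N` is a line preserved by `f`, because `f` commutes with `N`; the scalar is the
eigenvalue on that line. -/
theorem exists_scalar_of_hyperplane (f N : Module.End K V) (hc : Commute f N) (W : Submodule K V)
    (hW : Module.finrank K W + 1 = Module.finrank K V) (h : ∀ w ∈ W, N w = 0) (hN : N ≠ 0) :
    ∃ a : K, aeval f (X - C a) * N = 0 := by
  obtain ⟨l, w, hw, hl, hlW⟩ := exists_functional_of_hyperplane N W hW h hN
  obtain ⟨v, hv⟩ : ∃ v, N v ≠ 0 := by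
    by_contra! h'
    exact hN (LinearMap.ext h')
  have hv0 : l v ≠ 0 := fun h0 => hv (by rw [hl, h0, zero_smul])
  have key : ∀ u, l u • f w = l (f u) • w := fun u => by
    rw [← map_smul, ← hl, ← hl, ← Module.End.mul_apply, hc.eq, Module.End.mul_apply]
  have hfw : f w = ((l v)⁻¹ * l (f v)) • w := by
    rw [mul_smul, ← key, smul_smul, inv_mul_cancel₀ hv0, one_smul]
  refine ⟨(l v)⁻¹ * l (f v), LinearMap.ext fun u => ?_⟩
  rw [Module.End.mul_apply, hl, map_smul, map_sub, aeval_X, aeval_C, LinearMap.sub_apply,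
    Module.algebraMap_end_apply, hfw, sub_self, smul_zero, LinearMap.zero_apply]

/-- For a cyclic vector `v`, `N (q(f) v) = q(f) (N v) = q(a) N v`, so the image of `N` is spanned by
`N v`. -/
theorem finrank_ker_of_scalar (f N : Module.End K V) (hc : Commute f N) (v : V)
    (hv : ∀ w, ∃ q : K[X], aeval f q v = w) (a : K) (h : aeval f (X - C a) * N = 0) (hN : N ≠ 0) :
    Module.finrank K (LinearMap.ker N) + 1 = Module.finrank K V := by
  have hlt : Module.finrank K (LinearMap.ker N) < Module.finrank K V := by
    apply Submodule.finrank_lt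
    rwa [Ne, LinearMap.ker_eq_top]
  have hle : LinearMap.range N ≤ Submodule.span K {N v} := by
    rintro _ ⟨w, rfl⟩
    obtain ⟨q, rfl⟩ := hv w
    rw [Submodule.mem_span_singleton]
    refine ⟨q.eval a, ?_⟩
    have hcq : Commute (aeval f q) N := by
      induction q using Polynomial.induction_on' with
      | add p q hp hq => rw [map_add]; exact hp.add_left hq
      | monomial k b =>
        rw [aeval_monomial]
        exact (Algebra.commute_algebraMap_left b N).mul_left (hc.pow_left k)
    rw [← Module.End.mul_apply, ← hcq.eq, Module.End.mul_apply]
    obtain ⟨s, hs⟩ := X_sub_C_dvd_sub_C_eval (p := q) (a := a)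
    rw [sub_eq_iff_eq_add] at hs
    have h1 : aeval f ((X - C a) * s) (N v) = 0 := by
      rw [mul_comm, map_mul, Module.End.mul_apply, ← Module.End.mul_apply _ N, h,
        LinearMap.zero_apply, map_zero]
    conv_rhs => rw [hs, map_add, LinearMap.add_apply, h1, zero_add, aeval_C,
      Module.algebraMap_end_apply]
  have h1 := Submodule.finrank_mono hle
  have h2 : Module.finrank K (Submodule.span K {N v}) ≤ 1 := by
    simpa using finrank_span_le_card (R := K) ({N v} : Set V)
  have hrn := LinearMap.finrank_range_add_finrank_ker N
  omega

end Module.End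

theorem le_of_pow_dvd_pow_of_squarefree {F : Type*} [Field F] {h Q : F[X]} (hh : Irreducible h)
    (hQ : Squarefree Q) {a b : ℕ} (hd : h ^ a ∣ Q ^ b) : a ≤ b := by
  have h1 := le_emultiplicity_of_pow_dvd hd
  rw [emultiplicity_pow hh.prime] at h1
  have h2 := ((squarefree_iff_emultiplicity_le_one Q).1 hQ h).resolve_right hh.not_isUnit
  have h3 : (a : ℕ∞) ≤ b * 1 := h1.trans (mul_le_mul_right h2 _)
  rw [mul_one] at h3
  exact_mod_cast h3

/-! ### Powers of order `p` fixing a hyperplane -/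

section Hyperplane

variable {n p : ℕ} [Fact p.Prime]

/-- The power `σ ^ (o(σ) / p)` makes sense and fixes a hyperplane pointwise. -/
def FixesHyperplane (σ : GLnp n p) : Prop :=
  p ∣ orderOf σ ∧
    ∃ W : Submodule (ZMod p) (Fin n → ZMod p), Module.finrank (ZMod p) W = n - 1 ∧
      ∀ w ∈ W, ((σ ^ (orderOf σ / p) : GLnp n p) :
        Module.End (ZMod p) (Fin n → ZMod p)) w = w

theorem pow_orderOf_div_ne_one {G : Type*} [Group G] [Finite G] {x : G} (h : p ∣ orderOf x) :
    x ^ (orderOf x / p) ≠ 1 := by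
  obtain ⟨c, hc⟩ := h
  have hpos := orderOf_pos x
  have hp := (Fact.out : p.Prime)
  rw [hc, Nat.mul_div_cancel_left _ hp.pos]
  intro h1
  have h2 := orderOf_dvd_of_pow_eq_one h1
  have hc0 : 0 < c := Nat.pos_of_ne_zero (by rintro rfl; omega)
  have h3 := Nat.le_of_dvd hc0 h2
  have := hp.one_lt
  nlinarith

theorem fixesHyperplane_iff_exists_dvd (hn : 1 ≤ n) {σ : GLnp n p} (h : p ∣ orderOf σ)
    (hd : (minPoly σ).natDegree = n) :
    FixesHyperplane σ ↔ ∃ a : ZMod p, minPoly σ ∣ (X - C a) * (X ^ (orderOf σ / p) - 1) := by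
  have := finite_GLnp (n := n) (p := p)
  set f : Module.End (ZMod p) (Fin n → ZMod p) := Units.val σ
  set m := orderOf σ / p
  have hN : aeval f (X ^ m - 1 : (ZMod p)[X]) = ((σ ^ m : GLnp n p) : Module.End _ _) - 1 := by
    rw [map_sub, map_pow, aeval_X, map_one, Units.val_pow_eq_pow_val]
  have hN0 : aeval f (X ^ m - 1 : (ZMod p)[X]) ≠ 0 := by
    rw [hN, sub_ne_zero, ← Units.val_one, Ne, Units.val_inj]
    exact pow_orderOf_div_ne_one h
  have hc : Commute f (aeval f (X ^ m - 1 : (ZMod p)[X])) := by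
    have := Commute.all (X : (ZMod p)[X]) (X ^ m - 1)
    simpa only [aeval_X] using this.map (aeval f)
  have hfix : ∀ w, aeval f (X ^ m - 1 : (ZMod p)[X]) w = 0 ↔
      ((σ ^ m : GLnp n p) : Module.End (ZMod p) (Fin n → ZMod p)) w = w := fun w => by
    rw [hN, LinearMap.sub_apply, Module.End.one_apply, sub_eq_zero]
  have hfr := finrank_fin_fun_zmod (n := n) (p := p)
  constructor
  · rintro ⟨-, W, hW, hw⟩
    obtain ⟨a, ha⟩ := Module.End.exists_scalar_of_hyperplane f _ hc W (by rw [hW, hfr]; omega)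
      (fun w hw' => (hfix w).2 (hw w hw')) hN0
    exact ⟨a, (aeval_eq_zero_iff_minPoly_dvd σ _).1 (by rw [map_mul]; exact ha)⟩
  · rintro ⟨a, ha⟩
    obtain ⟨v, hv⟩ := Module.End.exists_cyclic_vector f (by rw [hfr]; exact hd)
    have ha' := (aeval_eq_zero_iff_minPoly_dvd σ _).2 ha
    rw [map_mul] at ha'
    have := Module.End.finrank_ker_of_scalar f _ hc v hv a ha' hN0
    exact ⟨h, LinearMap.ker (aeval f (X ^ m - 1 : (ZMod p)[X])), by omega,
      fun w hw => (hfix w).1 (LinearMap.mem_ker.1 hw)⟩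

theorem mem_allA_of_mem_finA {i j : ℕ} {g : (ZMod p)[X]} (hi : i ∈ Finset.Icc 1 n)
    (hg : g ∈ finA p i j) : g ∈ allA n p j :=
  Finset.mem_biUnion.2 ⟨i, hi, hg⟩

theorem mem_finA_of_mem_allA {j : ℕ} {g : (ZMod p)[X]} (hg : g ∈ allA n p j) :
    g ∈ finA p g.natDegree j := by
  obtain ⟨i, -, hi⟩ := Finset.mem_biUnion.1 hg
  rwa [(mem_finA.1 hi).2.2.2.1]

/-- With `Q = X^L - 1` squarefree, the minimal polynomial divides `(X - a) Q^(p^d)` but not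
`Q^(p^d)`. The first fact bounds all multiplicities by `p^d`, except that of `X - a`, which may be
one larger; the second says that it is. -/
theorem fixesHyperplane_iff_hasDominantLinearFactor (hn : 1 ≤ n) {σ : GLnp n p} {j : ℕ}
    {k : (ZMod p)[X] → ℕ} (hk : IsFactorization n p j k (minPoly σ)) :
    FixesHyperplane σ ↔ HasDominantLinearFactor n p j (orderOf σ) k := by
  have := finite_GLnp (n := n) (p := p)
  have hp := (Fact.out : p.Prime)
  by_cases hpo : p ∣ orderOf σ
  swap
  · refine iff_of_false (fun h => hpo h.1) fun h => hpo ?_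
    exact dvd_of_one_le_padicValNat h.1
  have ho : orderOf σ ≠ 0 := (orderOf_pos σ).ne'
  have he : 1 ≤ padicValNat p (orderOf σ) := one_le_padicValNat_of_dvd ho hpo
  obtain ⟨L, hL⟩ := (pow_padicValNat_dvd : p ^ padicValNat p (orderOf σ) ∣ orderOf σ)
  have hLp : ¬ p ∣ L := by
    rintro ⟨c, rfl⟩
    exact pow_succ_padicValNat_not_dvd (p := p) ho ⟨c, by rw [pow_succ]; linarith⟩
  rw [fixesHyperplane_iff_exists_dvd hn hpo hk.natDegree_eq, HasDominantLinearFactor]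
  generalize hev : padicValNat p (orderOf σ) = e at *
  obtain ⟨d, rfl⟩ : ∃ d, e = d + 1 := ⟨e - 1, by omega⟩
  rw [Nat.add_sub_cancel]
  set Q : (ZMod p)[X] := X ^ L - 1
  have hQs : Squarefree Q := by
    refine (X_pow_sub_one_separable_iff.2 ?_).squarefree
    rwa [Ne, ZMod.natCast_eq_zero_iff]
  have hdiv : (X ^ (orderOf σ / p) - 1 : (ZMod p)[X]) = Q ^ p ^ d := by
    have : orderOf σ / p = L * p ^ d := by
      rw [hL, pow_succ, mul_right_comm, Nat.mul_div_cancel _ hp.pos, mul_comm]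
    rw [this, sub_pow_char_pow, one_pow, ← pow_mul]
  have hfQ : minPoly σ ∣ Q ^ p ^ (d + 1) := by
    have h1 : Q ^ p ^ (d + 1) = X ^ orderOf σ - 1 := by
      rw [sub_pow_char_pow, one_pow, ← pow_mul, hL, mul_comm]
    rw [h1, ← aeval_eq_zero_iff_minPoly_dvd, map_sub, map_pow, aeval_X, map_one,
      ← Units.val_pow_eq_pow_val, pow_orderOf_eq_one, Units.val_one, sub_self]
  have hfQ' : ¬ minPoly σ ∣ Q ^ p ^ d := by
    rw [← hdiv, ← aeval_eq_zero_iff_minPoly_dvd, map_sub, map_pow, aeval_X, map_one,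
      ← Units.val_pow_eq_pow_val, sub_eq_zero, ← Units.val_one, Units.val_inj]
    exact pow_orderOf_div_ne_one hpo
  have hdvdQ : ∀ h ∈ allA n p j, k h ≠ 0 → h ∣ Q := fun h hh h0 =>
    (mem_allA.1 hh).2.2.2.1.prime.dvd_of_dvd_pow ((dvd_pow_self h h0).trans
      ((hk.pow_dvd hh).trans hfQ))
  have hpowQ : ∀ h ∈ allA n p j, k h ≤ p ^ d → h ^ k h ∣ Q ^ p ^ d := by
    intro h hh hle
    rcases eq_or_ne (k h) 0 with h0 | h0
    · rw [h0, pow_zero]; exact one_dvd _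
    · exact (pow_dvd_pow h hle).trans (pow_dvd_pow_of_dvd (hdvdQ h hh h0) _)
  have hclog : ∀ h, Nat.clog p (k h) < d + 1 ↔ k h ≤ p ^ d := fun h => by
    rw [Nat.lt_succ_iff, Nat.clog_le_iff_le_pow hp.one_lt]
  rw [hdiv]
  simp only [hclog]
  constructor
  · rintro ⟨a, ha⟩
    have hgi : Irreducible (X - C a) := irreducible_X_sub_C a
    have hother : ∀ h ∈ allA n p j, h ≠ X - C a → k h ≤ p ^ d := by
      intro h hh hne
      obtain ⟨-, -, hm, hi, -⟩ := mem_allA.1 hh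
      have hcop : IsCoprime (h ^ k h) (X - C a) :=
        (isCoprime_of_irreducible_monic_ne hi hgi hm (monic_X_sub_C a) hne).pow_left
      exact le_of_pow_dvd_pow_of_squarefree hi hQs
        (hcop.dvd_of_dvd_mul_left ((hk.pow_dvd hh).trans ha))
    -- Otherwise the minimal polynomial would divide `Q^(p^d)`, and `σ^(o/p)` would be the identity.
    obtain ⟨g, hg, hgt⟩ : ∃ g ∈ allA n p j, p ^ d < k g := by
      by_contra! h
      exact hfQ' (hk.dvd_of_forall_pow_dvd fun g hg => hpowQ g hg (h g hg))
    obtain rfl : g = X - C a := by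
      by_contra hne
      exact absurd (hother g hg hne) (by omega)
    -- Cancelling the extra factor `X - a` leaves a divisibility into `Q^(p^d)`.
    have hle : k (X - C a) - 1 ≤ p ^ d := by
      refine le_of_pow_dvd_pow_of_squarefree hgi hQs
        ((mul_dvd_mul_iff_left hgi.ne_zero).1 ?_)
      rw [← pow_succ', Nat.sub_add_cancel (by omega)]
      exact (hk.pow_dvd hg).trans ha
    refine ⟨he, X - C a, ⟨?_, by omega, fun i hi h hh hne => ?_⟩, ?_⟩
    · have := mem_finA_of_mem_allA hg
      rwa [natDegree_X_sub_C] at this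
    · exact hother h (mem_allA_of_mem_finA hi hh) hne
    -- A second such factor would have to bound the multiplicity of `X - a` by `p^d`.
    · rintro g' ⟨-, -, h3⟩
      by_contra hne
      have h1 := mem_finA_of_mem_allA hg
      rw [natDegree_X_sub_C] at h1
      have := h3 1 (Finset.mem_Icc.2 ⟨le_rfl, hn⟩) _ h1 (Ne.symm hne)
      omega
  · rintro ⟨-, g, ⟨hg, hkg, hother⟩, -⟩
    have hgA : g ∈ allA n p j := mem_allA_of_mem_finA (Finset.mem_Icc.2 ⟨le_rfl, hn⟩) hg
    obtain ⟨-, -, hm, h1, -⟩ := mem_finA.1 hg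
    have hgX : g = X - C (-g.coeff 0) := by
      rw [C_neg, sub_neg_eq_add]
      exact hm.eq_X_add_C h1
    refine ⟨-g.coeff 0, ?_⟩
    rw [← hgX]
    refine hk.dvd_of_forall_pow_dvd fun h hh => ?_
    rcases eq_or_ne h g with rfl | hne
    · rw [hkg, pow_succ']
      exact mul_dvd_mul_left _ (pow_dvd_pow_of_dvd (hdvdQ h hgA (by omega)) _)
    · have hh' := mem_finA_of_mem_allA hh
      obtain ⟨-, hdeg, -, hi, -⟩ := mem_allA.1 hh
      exact (hpowQ h hh (hother _ (Finset.mem_Icc.2 ⟨hi.natDegree_pos, hdeg⟩) h hh' hne)).mul_left _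

theorem FixesHyperplane.of_isConj {σ τ : GLnp n p} (h : FixesHyperplane σ) (hc : IsConj σ τ) :
    FixesHyperplane τ := by
  obtain ⟨hp, W, hW, hw⟩ := h
  obtain ⟨c, rfl⟩ := isConj_iff.1 hc
  have ho : orderOf (c * σ * c⁻¹) = orderOf σ := by
    simpa using (MulAut.conj c).orderOf_eq σ
  let e := LinearMap.GeneralLinearGroup.generalLinearEquiv (ZMod p) (Fin n → ZMod p) c
  refine ⟨ho ▸ hp, W.map (e : (Fin n → ZMod p) →ₗ[ZMod p] _), ?_, ?_⟩
  · rw [LinearEquiv.finrank_map_eq, hW]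
  · rintro _ ⟨w, hw', rfl⟩
    rw [ho, conj_pow]
    have h1 : (c * σ ^ (orderOf σ / p) * c⁻¹) * c = c * σ ^ (orderOf σ / p) := by group
    change (((c * σ ^ (orderOf σ / p) * c⁻¹) * c : GLnp n p) :
      Module.End (ZMod p) (Fin n → ZMod p)) w = (c : Module.End (ZMod p) (Fin n → ZMod p)) w
    rw [h1, Units.val_mul, Module.End.mul_apply, hw w hw']

theorem exists_mem_boldM₁_iff {M : Set (GLnp n p)} (hM : IsBoldM M) (σ : GLnp n p) :
    (∃ τ ∈ boldM₁ M, IsConj σ τ) ↔ HasMType σ ∧ FixesHyperplane σ := by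
  constructor
  · rintro ⟨τ, ⟨hτ, h⟩, hc⟩
    exact ⟨(hM.1 τ hτ).of_isConj hc.symm, FixesHyperplane.of_isConj h hc.symm⟩
  · rintro ⟨h1, h2⟩
    obtain ⟨τ, ⟨hτ, hc⟩, -⟩ := hM.2 σ h1
    exact ⟨τ, ⟨hτ, h2.of_isConj hc⟩, hc⟩

/-- A minimal polynomial of degree `n` determines the conjugacy class, so nothing is lost by passing
to polynomials. -/
theorem minPoly_mem_image_boldM₁_iff {M : Set (GLnp n p)} (hM : IsBoldM M) (σ : GLnp n p) :
    minPoly σ ∈ minPoly '' boldM₁ M ↔ ∃ τ ∈ boldM₁ M, IsConj σ τ := by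
  constructor
  · rintro ⟨τ, hτ, h⟩
    exact ⟨τ, hτ, (isConj_of_minPoly_eq (hM.1 τ hτ.1).1 h).symm⟩
  · rintro ⟨τ, hτ, hc⟩
    exact ⟨τ, hτ, (minPoly_eq_of_isConj hc).symm⟩

theorem image_minPoly_boldM₁_eq (hp : p ≠ 2) (hn : 1 ≤ n) {M : Set (GLnp n p)} (hM : IsBoldM M) :
    minPoly '' boldM₁ M =
      {f | ∃ σ ∈ M, minPoly σ = f ∧
        ∃ j ∈ Finset.Icc 1 (dMax n p), ∃ k : (ZMod p)[X] → ℕ,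
          IsFactorization n p j k f ∧ HasDominantLinearFactor n p j (orderOf σ) k} := by
  ext f
  constructor
  · rintro ⟨σ, ⟨hσ, h⟩, rfl⟩
    obtain ⟨j, hj, k, hk⟩ := (hM.1 σ hσ).exists_isFactorization hp hn
    exact ⟨σ, hσ, rfl, j, hj, k, hk, (fixesHyperplane_iff_hasDominantLinearFactor hn hk).1 h⟩
  · rintro ⟨σ, hσ, rfl, j, -, k, hk, h⟩
    exact ⟨σ, ⟨hσ, (fixesHyperplane_iff_hasDominantLinearFactor hn hk).2 h⟩, rfl⟩

end Hyperplane

/-! ### Automorphisms of a Cayley map -/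

namespace CayleyMap

variable {G : Type*} [Group G] (C : CayleyMap G)

section Basic

theorem aut_rot (φ : C.aut) (d : C.Dart) : φ.1 (C.rot d) = C.rot (φ.1 d) :=
  (DFunLike.congr_fun (Subgroup.mem_centralizer_iff.1 φ.2 C.rot (by simp)) d).symm

theorem aut_rev (φ : C.aut) (d : C.Dart) : φ.1 (C.rev d) = C.rev (φ.1 d) :=
  (DFunLike.congr_fun (Subgroup.mem_centralizer_iff.1 φ.2 C.rev (by simp)) d).symm

theorem mem_aut_iff (φ : Equiv.Perm C.Dart) :
    φ ∈ C.aut ↔ (∀ d, φ (C.rot d) = C.rot (φ d)) ∧ ∀ d, φ (C.rev d) = C.rev (φ d) := by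
  refine ⟨fun h => ⟨C.aut_rot ⟨φ, h⟩, C.aut_rev ⟨φ, h⟩⟩, fun h => ?_⟩
  rw [aut, Subgroup.mem_centralizer_iff]
  rintro _ (rfl | rfl)
  · exact Equiv.ext fun d => (h.1 d).symm
  · exact Equiv.ext fun d => (h.2 d).symm

theorem rot_zpow_apply (i : ℤ) (g : G) (s : C.S) : (C.rot ^ i) (g, s) = (g, (C.ρ ^ i) s) := by
  induction i generalizing s with
  | zero => rfl
  | succ i ih =>
    rw [zpow_add_one, zpow_add_one, Equiv.Perm.mul_apply, Equiv.Perm.mul_apply]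
    exact ih _
  | pred i ih =>
    rw [zpow_sub_one, zpow_sub_one, Equiv.Perm.mul_apply, Equiv.Perm.mul_apply]
    exact ih _

theorem aut_rot_zpow (φ : C.aut) (i : ℤ) (d : C.Dart) :
    φ.1 ((C.rot ^ i) d) = (C.rot ^ i) (φ.1 d) := by
  have h : Commute φ.1 C.rot := Equiv.ext (C.aut_rot φ)
  exact DFunLike.congr_fun (h.zpow_right i).eq d

/-- The darts at `g` form one cycle of the rotation, with which `φ` commutes; hence `φ` acts on
vertices. -/
theorem aut_fst_eq (φ : C.aut) (g : G) (s t : C.S) : (φ.1 (g, s)).1 = (φ.1 (g, t)).1 := by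
  obtain ⟨i, rfl⟩ := C.sameCycle s t
  rw [← C.rot_zpow_apply, C.aut_rot_zpow]
  obtain ⟨h, u⟩ := φ.1 (g, s)
  rw [C.rot_zpow_apply]

theorem aut_apply_eq_of_apply_eq (φ : C.aut) (g : G) (s t : C.S) (h : φ.1 (g, s) = (g, s)) :
    φ.1 (g, t) = (g, t) := by
  obtain ⟨i, rfl⟩ := C.sameCycle s t
  rw [← C.rot_zpow_apply, C.aut_rot_zpow, h]

/-- Induction along the edges of the map. -/
theorem vertex_induction {P : G → Prop} (g : G) (h1 : P g)
    (h : ∀ x, P x → ∀ s : C.S, P (x * s)) (x : G) : P x := by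
  have key : ∀ y ∈ Subgroup.closure C.S, P (g * y) := by
    intro y hy
    induction hy using Subgroup.closure_induction_right with
    | one => rwa [mul_one]
    | mul_right y _ s hs ih => rw [← mul_assoc]; exact h _ ih ⟨s, hs⟩
    | mul_inv_cancel y _ s hs ih => rw [← mul_assoc]; exact h _ ih ⟨s⁻¹, C.inv_mem s hs⟩
  have := key (g⁻¹ * x) (C.closure_eq_top ▸ Subgroup.mem_top _)
  rwa [mul_inv_cancel_left] at this

/-- An automorphism that fixes a dart is the identity. -/
theorem aut_eq_one_of_apply_eq (φ : C.aut) (d : C.Dart) (h : φ.1 d = d) : φ = 1 := by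
  obtain ⟨g, s⟩ := d
  have key : ∀ x, ∀ t, φ.1 (x, t) = (x, t) := by
    -- Rotation spreads the fixed dart around a vertex; reversal carries it to the neighbouring
    -- vertices.
    refine C.vertex_induction g (fun t => C.aut_apply_eq_of_apply_eq φ g s t h) fun x hx u t => ?_
    refine C.aut_apply_eq_of_apply_eq φ _ ⟨(u : G)⁻¹, C.inv_mem _ u.2⟩ _ ?_
    have := C.aut_rev φ (x, u)
    rw [hx] at this
    exact this
  exact Subtype.ext (Equiv.ext fun d => key d.1 d.2)

theorem nonempty_S [Nontrivial G] : Nonempty C.S := by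
  by_contra h
  rw [not_nonempty_iff, Set.isEmpty_coe_sort] at h
  have := C.closure_eq_top
  rw [h, Subgroup.closure_empty] at this
  exact bot_ne_top this

variable [Nonempty C.S]

/-- The action of the automorphism group on the vertices. -/
noncomputable def vhom : C.aut →* Equiv.Perm G :=
  MonoidHom.toHomPerm
    { toFun := fun φ g => (φ.1 (g, Classical.arbitrary C.S)).1
      map_one' := rfl
      map_mul' := fun φ ψ => funext fun g => C.aut_fst_eq φ _ (ψ.1 (g, Classical.arbitrary C.S)).2 _ }

theorem fst_apply (φ : C.aut) (g : G) (s : C.S) : (φ.1 (g, s)).1 = C.vhom φ g :=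
  C.aut_fst_eq φ g s _

theorem mapsVertex_iff (φ : C.aut) (g h : G) : C.MapsVertex φ g h ↔ C.vhom φ g = h :=
  ⟨fun H => H _, fun H s => (C.fst_apply φ g s).trans H⟩

theorem vhom_one_apply (g : G) : C.vhom 1 g = g := rfl

theorem vhom_mul_apply (φ ψ : C.aut) (g : G) : C.vhom (φ * ψ) g = C.vhom φ (C.vhom ψ g) := by
  rw [map_mul, Equiv.Perm.mul_apply]

theorem vhom_inv_apply_eq (φ : C.aut) {g h : G} (H : C.vhom φ g = h) : C.vhom φ⁻¹ h = g := by
  rw [map_inv, Equiv.Perm.inv_eq_iff_eq, H]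

theorem vhom_mul_dart (φ : C.aut) (g : G) (s : C.S) :
    C.vhom φ (g * s) = C.vhom φ g * (φ.1 (g, s)).2 := by
  have := congrArg Prod.fst (C.aut_rev φ (g, s))
  rw [← C.fst_apply φ g s]
  exact (C.fst_apply φ (g * s) _).symm.trans this

theorem vhom_injective : Function.Injective C.vhom := by
  rw [injective_iff_map_eq_one]
  intro φ h
  let s := Classical.arbitrary C.S
  refine C.aut_eq_one_of_apply_eq φ (1, s) (Prod.ext ?_ (Subtype.ext ?_))
  · rw [C.fst_apply, h]; rfl
  · have h1 := C.vhom_mul_dart φ 1 s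
    rw [h] at h1
    simpa using h1.symm

theorem vhom_eq_apply (φ : C.aut) {g h : G} (H : C.vhom φ g = h) (s : C.S) :
    φ.1 (g, s) = (h, (φ.1 (g, s)).2) :=
  Prod.ext ((C.fst_apply φ g s).trans H) rfl

/-- A group of automorphisms that moves the vertex `1` to all its neighbours moves it to all
vertices. -/
theorem exists_vhom_eq (K : Subgroup C.aut) (hK : ∀ s : C.S, ∃ k ∈ K, C.vhom k 1 = s) (g : G) :
    ∃ k ∈ K, C.vhom k 1 = g := by
  refine C.vertex_induction (P := fun g => ∃ k ∈ K, C.vhom k 1 = g) 1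
    ⟨1, K.one_mem, C.vhom_one_apply 1⟩ ?_ g
  rintro x ⟨k, hk, rfl⟩ s
  -- The edge leaving `k(1)` is pulled back by `k⁻¹` to an edge leaving `1`, where the hypothesis
  -- applies.
  obtain ⟨l, hl, hl1⟩ := hK (k⁻¹.1 (C.vhom k 1, s)).2
  refine ⟨k * l, K.mul_mem hk hl, ?_⟩
  have h1 : C.vhom k⁻¹ (C.vhom k 1) = 1 := C.vhom_inv_apply_eq k rfl
  have h2 := C.vhom_mul_dart k⁻¹ (C.vhom k 1) s
  rw [h1, one_mul] at h2
  rw [C.vhom_mul_apply, hl1, ← h2, ← C.vhom_mul_apply, mul_inv_cancel,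
    C.vhom_one_apply]

theorem vertexRegular_iff (T : Subgroup C.aut) : C.VertexRegular T ↔
    (∀ g, ∃ t ∈ T, C.vhom t 1 = g) ∧ ∀ t ∈ T, ∀ g, C.vhom t g = g → t = 1 := by
  simp only [VertexRegular, mapsVertex_iff]
  constructor
  · refine fun h => ⟨fun g => (h 1 g).exists, fun t ht g hg => ?_⟩
    exact (h g g).unique ⟨ht, hg⟩ ⟨T.one_mem, by rw [map_one]; rfl⟩
  · rintro ⟨h1, h2⟩ g h
    obtain ⟨a, ha, rfl⟩ := h1 g
    obtain ⟨b, hb, rfl⟩ := h1 h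
    refine ⟨b * a⁻¹, ⟨T.mul_mem hb (T.inv_mem ha), ?_⟩, ?_⟩
    · rw [C.vhom_mul_apply, C.vhom_inv_apply_eq a rfl]
    · rintro x ⟨hx, hx1⟩
      have h3 : b⁻¹ * (x * a) = 1 := by
        refine h2 _ (T.mul_mem (T.inv_mem hb) (T.mul_mem hx ha)) 1 ?_
        rw [C.vhom_mul_apply, C.vhom_mul_apply, hx1, C.vhom_inv_apply_eq b rfl]
      rw [inv_mul_eq_one.1 h3, mul_inv_cancel_right]

theorem VertexRegular.eq_of_vhom_eq {C : CayleyMap G} [Nonempty C.S] {T : Subgroup C.aut}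
    (h : C.VertexRegular T) {x y : C.aut} (hx : x ∈ T) (hy : y ∈ T) {g : G}
    (hxy : C.vhom x g = C.vhom y g) : x = y :=
  (h g (C.vhom y g)).unique ⟨hx, (C.mapsVertex_iff _ _ _).2 hxy⟩
    ⟨hy, (C.mapsVertex_iff _ _ _).2 rfl⟩

theorem vertexRegular_groupImage : C.VertexRegular C.groupImage := by
  have hv : ∀ g x, C.vhom (C.leftHom g) x = g * x := fun g x => rfl
  rw [vertexRegular_iff]
  refine ⟨fun g => ⟨C.leftHom g, ⟨g, rfl⟩, by rw [hv, mul_one]⟩, ?_⟩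
  rintro _ ⟨g, rfl⟩ x hx
  rw [hv, mul_eq_right] at hx
  rw [hx, map_one]

theorem leftHom_injective : Function.Injective C.leftHom := by
  intro g h H
  have := congrArg (fun φ => C.vhom φ 1) H
  change g * 1 = h * 1 at this
  simpa using this

end Basic

section LocalRotation

variable {C}

theorem zpow_apply_of_localRotation {r : C.aut}
    (hr : ∀ s : C.S, r.1 (1, s) = (1, C.ρ s)) (i : ℤ) (s : C.S) :
    (r ^ i : C.aut).1 (1, s) = (1, (C.ρ ^ i) s) := by
  induction i generalizing s with
  | zero => rfl
  | succ i ih =>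
    rw [zpow_add_one, zpow_add_one]
    change (r ^ (i : ℤ) : C.aut).1 (r.1 (1, s)) = _
    rw [hr, ih]
    rfl
  | pred i ih =>
    rw [zpow_sub_one, zpow_sub_one]
    have h1 : (r⁻¹ : C.aut).1 (1, s) = (1, C.ρ⁻¹ s) := by
      change (r.1)⁻¹ (1, s) = _
      rw [Equiv.Perm.inv_eq_iff_eq, hr]
      simp
    change (r ^ (-(i : ℤ)) : C.aut).1 ((r⁻¹ : C.aut).1 (1, s)) = _
    rw [h1, ih]
    rfl

theorem vhom_zpow_apply_of_localRotation [Nonempty C.S] {r : C.aut}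
    (hr : ∀ s : C.S, r.1 (1, s) = (1, C.ρ s)) (i : ℤ) (s : C.S) :
    C.vhom (r ^ i) s = (C.ρ ^ i) s := by
  have h := C.vhom_mul_dart (r ^ i) 1 s
  have h1 := C.fst_apply (r ^ i) 1 s
  rw [zpow_apply_of_localRotation hr] at h h1
  rw [← h1, one_mul, one_mul] at h
  exact h

theorem vhom_zpow_one_of_localRotation [Nonempty C.S] {r : C.aut}
    (hr : ∀ s : C.S, r.1 (1, s) = (1, C.ρ s)) (i : ℤ) : C.vhom (r ^ i) 1 = 1 := by
  have h1 := C.fst_apply (r ^ i) 1 (Classical.arbitrary C.S)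
  rw [zpow_apply_of_localRotation hr] at h1
  exact h1.symm

/-- Some power of `r` agrees with `φ` on one dart at `1`, hence everywhere. -/
theorem exists_zpow_eq_of_vhom_one [Nonempty C.S] {r : C.aut}
    (hr : ∀ s : C.S, r.1 (1, s) = (1, C.ρ s)) (φ : C.aut) (hφ : C.vhom φ 1 = 1) :
    ∃ i : ℤ, φ = r ^ i := by
  let s := Classical.arbitrary C.S
  obtain ⟨i, hi⟩ := C.sameCycle s (φ.1 (1, s)).2
  refine ⟨i, ?_⟩
  rw [← mul_inv_eq_one, ← inv_inj, inv_one, mul_inv_rev, inv_inv]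
  refine C.aut_eq_one_of_apply_eq _ (φ.1 (1, s)) ?_
  have h1 := C.vhom_eq_apply φ hφ s
  change (r ^ i : C.aut).1 (φ.1⁻¹ (φ.1 (1, s))) = φ.1 (1, s)
  have h2 : φ.1⁻¹ (φ.1 (1, s)) = (1, s) := φ.1.symm_apply_apply _
  rw [h2, zpow_apply_of_localRotation hr, hi, ← h1]

end LocalRotation

/-! ### The translation group and the action of the local rotation -/

section TranslationModel

variable {n p : ℕ} {C}

/-- A vertex-regular subgroup `T` of the automorphism group, parametrised by `𝔽_p^n` in such a way
that the local rotation `r` at the vertex `1` acts on it as `σ`. -/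
structure TranslationModel (C : CayleyMap G) (T : Subgroup C.aut) (σ : GLnp n p) where
  /-- the local rotation at the vertex `1` -/
  r : C.aut
  r_apply : ∀ s : C.S, r.1 (1, s) = (1, C.ρ s)
  /-- the parametrisation -/
  t : (Fin n → ZMod p) → C.aut
  t_add : ∀ u v, t (u + v) = t u * t v
  t_injective : Function.Injective t
  t_mem : ∀ v, t v ∈ T
  exists_t_eq : ∀ x ∈ T, ∃ v, t v = x
  t_act : ∀ v, t ((σ : Module.End (ZMod p) (Fin n → ZMod p)) v) = r * t v * r⁻¹
  vertexRegular : C.VertexRegular T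

theorem ActsAs.nonempty_translationModel {T : Subgroup C.aut} {σ : GLnp n p}
    (h : C.ActsAs T σ) : Nonempty (TranslationModel C T σ) := by
  obtain ⟨-, hreg, r, hr, e, he⟩ := h
  exact ⟨{
    r := r
    r_apply := hr
    t := fun v => e (Multiplicative.ofAdd v)
    t_add := fun u v => by rw [ofAdd_add, map_mul, Subgroup.coe_mul]
    t_injective := fun u v H => Multiplicative.ofAdd.injective (e.injective (Subtype.ext H))
    t_mem := fun v => (e _).2
    exists_t_eq := fun x hx => ⟨Multiplicative.toAdd (e.symm ⟨x, hx⟩), by simp⟩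
    t_act := he
    vertexRegular := hreg }⟩

namespace TranslationModel

variable {T : Subgroup C.aut} {σ : GLnp n p} (m : TranslationModel C T σ)

theorem t_zero : m.t 0 = 1 := by
  have := m.t_add 0 0
  rwa [add_zero, left_eq_mul] at this

theorem t_neg (v : Fin n → ZMod p) : m.t (-v) = (m.t v)⁻¹ := by
  rw [eq_inv_iff_mul_eq_one, ← m.t_add, neg_add_cancel, m.t_zero]

theorem t_act_zpow (i : ℤ) (v : Fin n → ZMod p) :
    m.t (((σ ^ i : GLnp n p) : Module.End (ZMod p) (Fin n → ZMod p)) v) =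
      m.r ^ i * m.t v * (m.r ^ i)⁻¹ := by
  induction i generalizing v with
  | zero => simp
  | succ i ih =>
    rw [zpow_add_one, zpow_add_one, Units.val_mul, Module.End.mul_apply, ih, m.t_act]
    group
  | pred i ih =>
    have h1 : ∀ u, m.t (((σ⁻¹ : GLnp n p) : Module.End (ZMod p) (Fin n → ZMod p)) u) =
        m.r⁻¹ * m.t u * m.r := by
      intro u
      have h2 := m.t_act (((σ⁻¹ : GLnp n p) : Module.End (ZMod p) (Fin n → ZMod p)) u)
      rw [← Module.End.mul_apply, Units.mul_inv, Module.End.one_apply] at h2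
      rw [h2]
      group
    rw [zpow_sub_one, zpow_sub_one, Units.val_mul, Module.End.mul_apply, ih, h1]
    group

theorem t_act_pow (i : ℕ) (v : Fin n → ZMod p) :
    m.t (((σ ^ i : GLnp n p) : Module.End (ZMod p) (Fin n → ZMod p)) v) =
      m.r ^ i * m.t v * (m.r ^ i)⁻¹ := by
  have := m.t_act_zpow i v
  rwa [zpow_natCast, zpow_natCast] at this

variable [Nonempty C.S]

theorem exists_vhom_t_eq (g : G) : ∃ v, C.vhom (m.t v) 1 = g := by
  obtain ⟨x, hx, rfl⟩ := ((C.vertexRegular_iff T).1 m.vertexRegular).1 g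
  obtain ⟨v, rfl⟩ := m.exists_t_eq x hx
  exact ⟨v, rfl⟩

theorem eq_of_vhom_t_eq {u v : Fin n → ZMod p} {g : G}
    (h : C.vhom (m.t u) g = C.vhom (m.t v) g) : u = v :=
  m.t_injective (m.vertexRegular.eq_of_vhom_eq (m.t_mem u) (m.t_mem v) h)

theorem exists_eq_t_mul_zpow (x : C.aut) : ∃ v, ∃ i : ℤ, x = m.t v * m.r ^ i := by
  obtain ⟨v, hv⟩ := m.exists_vhom_t_eq (C.vhom x 1)
  obtain ⟨i, hi⟩ := exists_zpow_eq_of_vhom_one m.r_apply ((m.t v)⁻¹ * x) (by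
    rw [C.vhom_mul_apply, C.vhom_inv_apply_eq _ hv])
  exact ⟨v, i, by rw [← hi, mul_inv_cancel_left]⟩

theorem zpow_eq_one_of_mem {H : Subgroup C.aut} (hH : C.VertexRegular H) (i : ℤ)
    (h : m.r ^ i ∈ H) : m.r ^ i = 1 :=
  ((C.vertexRegular_iff H).1 hH).2 _ h 1 (vhom_zpow_one_of_localRotation m.r_apply i)

/-- If `σ^i = 1`, then `r^i` commutes with the transitive group `T` and fixes the vertex `1`, so it
fixes every vertex. -/
theorem zpow_eq_one_iff (i : ℤ) : σ ^ i = 1 ↔ m.r ^ i = 1 := by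
  constructor
  · intro h
    apply C.vhom_injective
    ext g
    obtain ⟨v, rfl⟩ := m.exists_vhom_t_eq g
    have h1 := m.t_act_zpow i v
    rw [h, Units.val_one, Module.End.one_apply, eq_mul_inv_iff_mul_eq] at h1
    rw [← C.vhom_mul_apply, ← h1, C.vhom_mul_apply, vhom_zpow_one_of_localRotation m.r_apply,
      C.vhom_one_apply]
  · intro h
    refine Units.ext (LinearMap.ext fun v => m.t_injective ?_)
    rw [m.t_act_zpow, h]
    simp

/-- The vectors translating `1` to its neighbours form one `σ`-orbit. Connectedness makes any of
them cyclic, and reversing an edge puts the negative of one in the orbit; a power of `σ` negating a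
cyclic vector is `-I`. -/
theorem hasMType [Fact p.Prime] (m : TranslationModel C T σ) : HasMType σ := by
  have := finite_GLnp (n := n) (p := p)
  choose w hw using fun s : C.S => m.exists_vhom_t_eq (s : G)
  have hact : ∀ (i : ℤ) (s : C.S),
      ((σ ^ i : GLnp n p) : Module.End (ZMod p) (Fin n → ZMod p)) (w s) = w ((C.ρ ^ i) s) := by
    intro i s
    apply m.eq_of_vhom_t_eq (g := 1)
    have h1 : C.vhom (m.r ^ i)⁻¹ 1 = 1 :=
      C.vhom_inv_apply_eq _ (vhom_zpow_one_of_localRotation m.r_apply i)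
    rw [m.t_act_zpow, hw, C.vhom_mul_apply, C.vhom_mul_apply, h1, hw,
      vhom_zpow_apply_of_localRotation m.r_apply]
  set f : Module.End (ZMod p) (Fin n → ZMod p) := Units.val σ
  let s₀ := Classical.arbitrary C.S
  have hpow : ∀ s : C.S, ∃ k : ℕ, (f ^ k) (w s₀) = w s := by
    intro s
    obtain ⟨i, rfl⟩ := C.sameCycle s₀ s
    obtain ⟨k, hk⟩ := mem_powers_iff_mem_zpowers.2 (Subgroup.mem_zpowers_iff.2 ⟨i, rfl⟩ :
      σ ^ i ∈ Subgroup.zpowers σ)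
    refine ⟨k, ?_⟩
    rw [← hact, ← hk]
    simp [f]
  let U : Submodule (ZMod p) (Fin n → ZMod p) :=
    LinearMap.range ((LinearMap.applyₗ (w s₀) :
      Module.End (ZMod p) (Fin n → ZMod p) →ₗ[ZMod p] _) ∘ₗ (aeval f).toLinearMap)
  have hU : ∀ v, v ∈ U ↔ ∃ q : (ZMod p)[X], aeval f q (w s₀) = v := fun v => LinearMap.mem_range
  let K : Subgroup C.aut :=
    { carrier := {x | ∃ u ∈ U, m.t u = x}
      mul_mem' := by
        rintro _ _ ⟨u, hu, rfl⟩ ⟨v, hv, rfl⟩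
        exact ⟨u + v, U.add_mem hu hv, m.t_add u v⟩
      one_mem' := ⟨0, U.zero_mem, m.t_zero⟩
      inv_mem' := by
        rintro _ ⟨u, hu, rfl⟩
        exact ⟨-u, U.neg_mem hu, m.t_neg u⟩ }
  have hcyc : ∀ v, ∃ q : (ZMod p)[X], aeval f q (w s₀) = v := by
    intro v
    obtain ⟨_, ⟨u, hu, rfl⟩, hk⟩ := C.exists_vhom_eq K (fun s => by
      obtain ⟨k, hk⟩ := hpow s
      exact ⟨_, ⟨w s, (hU _).2 ⟨X ^ k, by rw [map_pow, aeval_X, hk]⟩, rfl⟩, hw s⟩)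
      (C.vhom (m.t v) 1)
    rw [← m.eq_of_vhom_t_eq hk]
    exact (hU u).1 hu
  have hd := Module.End.natDegree_minpoly_of_cyclic f _ hcyc
  rw [finrank_fin_fun_zmod] at hd
  refine ⟨hd, (neg_one_mem_zpowers_iff σ).2 ?_⟩
  -- Translation by `-w s₀` carries the edge from `s₀` to `1` to an edge leaving `1`.
  have hneg : ∃ s : C.S, w s = -w s₀ := by
    have h1 : C.vhom (m.t (-w s₀)) s₀ = 1 := by
      rw [m.t_neg]
      exact C.vhom_inv_apply_eq _ (hw s₀)
    have h2 := C.vhom_mul_dart (m.t (-w s₀)) s₀ ⟨(s₀ : G)⁻¹, C.inv_mem _ s₀.2⟩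
    rw [h1, one_mul, mul_inv_cancel] at h2
    exact ⟨_, m.eq_of_vhom_t_eq (g := 1) ((hw _).trans h2.symm)⟩
  obtain ⟨s, hs⟩ := hneg
  obtain ⟨k, hk⟩ := hpow s
  refine ⟨k, (aeval_eq_zero_iff_minPoly_dvd σ _).1 (LinearMap.ext fun v => ?_)⟩
  obtain ⟨q, rfl⟩ := hcyc v
  change aeval f (X ^ k + 1 : (ZMod p)[X]) (aeval f q (w s₀)) = 0
  rw [← Module.End.mul_apply, ← map_mul, mul_comm, map_mul, Module.End.mul_apply, map_add,
    map_pow, aeval_X, map_one, LinearMap.add_apply, hk, hs, Module.End.one_apply, neg_add_cancel,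
    map_zero]

end TranslationModel

end TranslationModel

end CayleyMap

/-- A finite cyclic group has only one subgroup of order `p`. -/
theorem pow_orderOf_div_mem_zpowers {G : Type*} [Group G] {p : ℕ} [Fact p.Prime] {x : G} {i : ℤ}
    (h1 : x ^ i ≠ 1) (h2 : (x ^ i) ^ p = 1) :
    p ∣ orderOf x ∧ x ^ (orderOf x / p) ∈ Subgroup.zpowers (x ^ i) := by
  have hp := (Fact.out : p.Prime)
  have ho : orderOf (x ^ i) = p := orderOf_eq_prime h2 h1
  have hdvd : p ∣ orderOf x := ho ▸ orderOf_dvd_of_mem_zpowers ⟨i, rfl⟩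
  refine ⟨hdvd, ?_⟩
  obtain ⟨c, hc⟩ := hdvd
  rw [hc, Nat.mul_div_cancel_left _ hp.pos]
  have h3 : (orderOf x : ℤ) ∣ i * p := by
    rw [orderOf_dvd_iff_zpow_eq_one, zpow_mul, zpow_natCast, h2]
  have hp0 : (p : ℤ) ≠ 0 := by exact_mod_cast hp.ne_zero
  obtain ⟨m, rfl⟩ : (c : ℤ) ∣ i := by
    rw [hc, Nat.cast_mul, mul_comm (p : ℤ)] at h3
    exact (mul_dvd_mul_iff_right hp0).1 h3
  have hxc : (x ^ c) ^ (p : ℤ) = 1 := by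
    rw [zpow_natCast, ← pow_mul, mul_comm, ← hc, pow_orderOf_eq_one]
  have hm : ¬ (p : ℤ) ∣ m := by
    rintro ⟨m', rfl⟩
    apply h1
    rw [zpow_mul, zpow_natCast, zpow_mul, hxc, one_zpow]
  have hcop : IsCoprime (p : ℤ) m :=
    (Nat.prime_iff_prime_int.1 hp).irreducible.coprime_iff_not_dvd.2 hm
  obtain ⟨a, b, hab⟩ := hcop
  refine ⟨b, ?_⟩
  have h4 : (x ^ c) ^ (a * p + b * m) = x ^ c := by rw [hab, zpow_one]
  rw [zpow_add, mul_comm a, zpow_mul, hxc, one_zpow, one_mul] at h4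
  change (x ^ ((c : ℤ) * m)) ^ b = _
  rw [zpow_mul, zpow_natCast, ← zpow_mul, mul_comm m b, h4]

/-! ### Regular subgroups meeting the translations in index `p` -/

namespace CayleyMap.TranslationModel

variable {G : Type*} [Group G] {C : CayleyMap G} {n p : ℕ} {T : Subgroup C.aut} {σ : GLnp n p}

theorem exists_t_mul_zpow_pow (m : TranslationModel C T σ) (u : Fin n → ZMod p) (i : ℤ) (k : ℕ) :
    ∃ v, (m.t u * m.r ^ i) ^ k = m.t v * (m.r ^ i) ^ k := by
  induction k with
  | zero => exact ⟨0, by simp [m.t_zero]⟩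
  | succ k ih =>
    obtain ⟨v, hv⟩ := ih
    refine ⟨v + ((σ ^ (i * k) : GLnp n p) : Module.End (ZMod p) (Fin n → ZMod p)) u, ?_⟩
    rw [pow_succ, hv, m.t_add, m.t_act_zpow, zpow_mul, zpow_natCast, pow_succ]
    group

variable [Fact p.Prime] [Nonempty C.S]

/-- If a vertex-regular elementary abelian subgroup meets the translation group in a subgroup of
index `p`, then `p` is odd and a power of `σ` of order `p` fixes a hyperplane. -/
theorem fixesHyperplane (m : TranslationModel C T σ) (hn : 1 ≤ n) {H : Subgroup C.aut}
    (hH : C.VertexRegular H) (hab : IsElemAb p n H)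
    (hTH : IsElemAb p (n - 1) (T ⊓ H : Subgroup C.aut)) : p ≠ 2 ∧ FixesHyperplane σ := by
  have hp := (Fact.out : p.Prime)
  obtain ⟨eH⟩ := hab
  obtain ⟨eI⟩ := hTH
  have hcardH : Nat.card H = p ^ n := by
    rw [Nat.card_congr eH.toEquiv, Nat.card_congr Multiplicative.toAdd]
    simp
  have hcardI : Nat.card (T ⊓ H : Subgroup C.aut) = p ^ (n - 1) := by
    rw [Nat.card_congr eI.toEquiv, Nat.card_congr Multiplicative.toAdd]
    simp
  have hcomm : ∀ x ∈ H, ∀ y ∈ H, x * y = y * x := by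
    intro x hx y hy
    have : (⟨x, hx⟩ * ⟨y, hy⟩ : H) = ⟨y, hy⟩ * ⟨x, hx⟩ := eH.injective (by
      rw [map_mul, map_mul, mul_comm])
    exact congrArg Subtype.val this
  have hpow : ∀ x ∈ H, x ^ p = 1 := by
    intro x hx
    have : (⟨x, hx⟩ : H) ^ p = 1 := eH.injective (by
      rw [map_pow, map_one]
      apply Multiplicative.toAdd.injective
      rw [toAdd_pow, toAdd_one]
      ext j
      simp)
    exact congrArg Subtype.val this
  obtain ⟨h, hhH, hhT⟩ : ∃ h ∈ H, h ∉ T := by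
    by_contra! hle
    have : (T ⊓ H : Subgroup C.aut) = H := inf_eq_right.2 hle
    rw [this, hcardH] at hcardI
    have := Nat.pow_right_injective hp.two_le hcardI
    omega
  obtain ⟨u, i, rfl⟩ := m.exists_eq_t_mul_zpow h
  have hri : m.r ^ i ≠ 1 := by
    intro h1
    rw [h1, mul_one] at hhT
    exact hhT (m.t_mem u)
  let A : AddSubgroup (Fin n → ZMod p) :=
    { carrier := {v | m.t v ∈ H}
      add_mem' := fun {a b} ha hb => by
        change m.t (a + b) ∈ H
        rw [m.t_add]
        exact H.mul_mem ha hb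
      zero_mem' := by
        change m.t 0 ∈ H
        rw [m.t_zero]
        exact H.one_mem
      neg_mem' := fun {a} ha => by
        change m.t (-a) ∈ H
        rw [m.t_neg]
        exact H.inv_mem ha }
  let W : Submodule (ZMod p) (Fin n → ZMod p) := AddSubgroup.toZModSubmodule p A
  have hW : ∀ v, v ∈ W ↔ m.t v ∈ H := fun v => Iff.rfl
  have hcardW : Nat.card W = p ^ (n - 1) := by
    rw [← hcardI]
    refine Nat.card_congr (Equiv.ofBijective
      (fun v => ⟨m.t v.1, m.t_mem v.1, (hW _).1 v.2⟩) ⟨fun a b hab => ?_, ?_⟩)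
    · exact Subtype.ext (m.t_injective (congrArg Subtype.val hab))
    · rintro ⟨x, hxT, hxH⟩
      obtain ⟨v, rfl⟩ := m.exists_t_eq x hxT
      exact ⟨⟨v, (hW v).2 hxH⟩, rfl⟩
  have hWr : Module.finrank (ZMod p) W = n - 1 := by
    have := Module.natCard_eq_pow_finrank (K := ZMod p) (V := W)
    rw [hcardW, Nat.card_zmod] at this
    exact (Nat.pow_right_injective hp.two_le this).symm
  -- Both `t_u r^i` and `t_u` commute with `t_w`, hence so does `r^i`.
  have hfix : ∀ w ∈ W, ((σ ^ i : GLnp n p) : Module.End (ZMod p) (Fin n → ZMod p)) w = w := by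
    intro w hw
    apply m.t_injective
    have h1 := hcomm _ hhH _ ((hW w).1 hw)
    have h2 : m.t u * m.t w = m.t w * m.t u := by rw [← m.t_add, ← m.t_add, add_comm]
    rw [m.t_act_zpow, mul_inv_eq_iff_eq_mul]
    apply mul_left_cancel (a := m.t u)
    rw [← mul_assoc, h1, ← mul_assoc, ← mul_assoc, h2]
  -- The `p`-th power of `t_u r^i` is trivial, so `r^(ip)` is a translation fixing `1`.
  have hσp : (σ ^ i) ^ p = 1 := by
    obtain ⟨v, hv⟩ := m.exists_t_mul_zpow_pow u i p
    rw [hpow _ hhH, eq_comm, mul_eq_one_iff_eq_inv', ← zpow_natCast, ← zpow_mul] at hv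
    rw [← zpow_natCast, ← zpow_mul, m.zpow_eq_one_iff]
    refine m.zpow_eq_one_of_mem m.vertexRegular _ ?_
    rw [hv]
    exact T.inv_mem (m.t_mem v)
  have hσ : σ ^ i ≠ 1 := fun h1 => hri ((m.zpow_eq_one_iff i).1 h1)
  obtain ⟨hpo, hmem⟩ := pow_orderOf_div_mem_zpowers hσ hσp
  refine ⟨?_, hpo, W, hWr, fun w hw => ?_⟩
  · rintro rfl
    have hr2 : m.r ^ i * m.r ^ i = 1 := by
      rw [← pow_two, ← zpow_natCast, ← zpow_mul, ← m.zpow_eq_one_iff, zpow_mul, zpow_natCast, hσp]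
    -- Squaring `t_u r^i` gives `u + σ^i u = 0`. In characteristic 2 this means that `σ^i` fixes
    -- `u`, so `u ∈ W`; then both `t_u` and `r^i` lie in `H`, contradicting regularity.
    have h1 : m.t (u + ((σ ^ i : GLnp n 2) : Module.End (ZMod 2) (Fin n → ZMod 2)) u) = m.t 0 := by
      have h2 := hpow _ hhH
      have h3 : (m.r ^ i)⁻¹ = m.r ^ i := inv_eq_of_mul_eq_one_right hr2
      rw [m.t_add, m.t_act_zpow, m.t_zero, h3, ← h2, pow_two]
      group
    have h4 : ((σ ^ i : GLnp n 2) : Module.End (ZMod 2) (Fin n → ZMod 2)) u = u := by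
      have h5 := m.t_injective h1
      have h6 : u + u = 0 := by
        ext j
        exact CharTwo.add_self_eq_zero (u j)
      exact add_left_cancel (h5.trans h6.symm)
    have hN : ((σ ^ i : GLnp n 2) : Module.End (ZMod 2) (Fin n → ZMod 2)) - 1 ≠ 0 := by
      rw [sub_ne_zero, ← Units.val_one, Ne, Units.val_inj]
      exact hσ
    obtain ⟨l, w₁, hw₁, hl, hlW⟩ := Module.End.exists_functional_of_hyperplane _ W
      (by rw [hWr, finrank_fin_fun_zmod]; omega)
      (fun w hw => by rw [LinearMap.sub_apply, hfix w hw, Module.End.one_apply, sub_self]) hN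
    have h7 := hl u
    rw [LinearMap.sub_apply, h4, Module.End.one_apply, sub_self, eq_comm, smul_eq_zero] at h7
    have hu : m.t u ∈ H := (hW u).1 ((hlW u).1 (h7.resolve_right hw₁))
    exact hri (m.zpow_eq_one_of_mem hH i ((H.mul_mem_cancel_left hu).1 hhH))
  · obtain ⟨a, ha⟩ := hmem
    have h1 : σ ^ i ∈ MulAction.stabilizer (GLnp n p) w := hfix w hw
    have h2 := Subgroup.zpow_mem _ h1 a
    change (σ ^ i) ^ a = _ at ha
    rw [ha] at h2
    exact h2

/-- If `p` is odd and a power of `σ` of order `p` fixes a hyperplane, then the automorphism group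
has a vertex-regular elementary abelian subgroup that meets the translation group in a subgroup of
index `p`. -/
theorem exists_vertexRegular (m : TranslationModel C T σ) (hn : 1 ≤ n) (hp2 : p ≠ 2)
    (hσ : FixesHyperplane σ) : ∃ H : Subgroup C.aut, C.VertexRegular H ∧ IsElemAb p n H ∧
      IsElemAb p (n - 1) (T ⊓ H : Subgroup C.aut) := by
  have := finite_GLnp (n := n) (p := p)
  have hp := (Fact.out : p.Prime)
  obtain ⟨hpo, W, hWr, hfix⟩ := hσ
  set c := orderOf σ / p with hc
  set A : Module.End (ZMod p) (Fin n → ZMod p) := Units.val (σ ^ c) with hA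
  have hN : A - 1 ≠ 0 := by
    rw [sub_ne_zero, ← Units.val_one, hA, Ne, Units.val_inj]
    exact pow_orderOf_div_ne_one hpo
  obtain ⟨l, w, hw0, hl, hlW⟩ := Module.End.exists_functional_of_hyperplane (A - 1) W
    (by rw [hWr, finrank_fin_fun_zmod]; omega)
    (fun x hx => by rw [LinearMap.sub_apply, hfix x hx, Module.End.one_apply, sub_self]) hN
  have hAv : ∀ v, A v = v + l v • w := fun v => by
    rw [← hl, LinearMap.sub_apply, Module.End.one_apply, add_sub_cancel]
  -- Here `w` is an eigenvector of `A` with eigenvalue `1 + l w`, and `A^p = 1`; by Fermat `(1 + l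
  -- w)^p = 1 + l w`.
  have hlw : l w = 0 := by
    have h1 : ∀ k : ℕ, (A ^ k) w = (1 + l w) ^ k • w := by
      intro k
      induction k with
      | zero => simp
      | succ k ih =>
        rw [pow_succ', Module.End.mul_apply, ih, map_smul, hAv w, pow_succ, mul_smul, add_smul,
          one_smul]
    have h2 : A ^ p = 1 := by
      rw [hA, ← Units.val_pow_eq_pow_val, ← pow_mul, hc, Nat.div_mul_cancel hpo,
        pow_orderOf_eq_one, Units.val_one]
    have h3 := h1 p
    rw [h2, ZMod.pow_card, Module.End.one_apply, add_smul, one_smul, left_eq_add,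
      smul_eq_zero] at h3
    exact h3.resolve_right hw0
  have hApow : ∀ (k : ℕ) v, (A ^ k) v = v + (k * l v) • w := by
    intro k v
    induction k with
    | zero => simp
    | succ k ih =>
      rw [pow_succ', Module.End.mul_apply, ih, hAv, map_add, map_smul, hlw, smul_zero, add_zero,
        add_assoc, ← add_smul]
      push_cast
      ring_nf
  set ψ := m.r ^ c with hψ
  have hψA : ∀ (k : ℕ) v, ψ ^ k * m.t v = m.t (v + (k * l v) • w) * ψ ^ k := by
    intro k v
    have h1 := m.t_act_pow (c * k) v
    rw [pow_mul, Units.val_pow_eq_pow_val, ← hA, hApow, pow_mul, ← hψ] at h1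
    rw [h1, inv_mul_cancel_right]
  have hψp : ψ ^ p = 1 := by
    rw [hψ, ← pow_mul, hc, Nat.div_mul_cancel hpo, ← zpow_natCast, ← m.zpow_eq_one_iff,
      zpow_natCast, pow_orderOf_eq_one]
  have hψadd : ∀ a b : ZMod p, ψ ^ (a + b).val = ψ ^ a.val * ψ ^ b.val := by
    intro a b
    rw [ZMod.val_add, ← pow_eq_pow_mod _ hψp, pow_add]
  have hψT : ∀ a : ZMod p, ψ ^ a.val ∈ T → a = 0 := by
    intro a ha
    have h1 : ψ ^ a.val = 1 := by
      rw [hψ, ← pow_mul, ← zpow_natCast] at ha ⊢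
      exact m.zpow_eq_one_of_mem m.vertexRegular _ ha
    obtain ⟨v, hv⟩ : ∃ v, l v ≠ 0 := by
      by_contra! h'
      exact hN (LinearMap.ext fun v => by rw [hl, h', zero_smul, LinearMap.zero_apply])
    have h2 := hψA a.val v
    rw [h1, one_mul, mul_one] at h2
    have h3 := m.t_injective h2
    rw [left_eq_add, smul_eq_zero, ZMod.natCast_zmod_val] at h3
    exact (mul_eq_zero.1 (h3.resolve_right hw0)).resolve_right hv
  have hψ1 : ∀ k : ℕ, C.vhom (ψ ^ k) 1 = 1 := by
    intro k
    rw [hψ, ← pow_mul, ← zpow_natCast]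
    exact vhom_zpow_one_of_localRotation m.r_apply _
  have h2ne : (2 : ZMod p) ≠ 0 := by
    intro h
    have h3 := (ZMod.natCast_eq_zero_iff 2 p).1 (by exact_mod_cast h)
    exact hp2 ((Nat.prime_dvd_prime_iff_eq hp Nat.prime_two).1 h3)
  -- Moving `ψ^(l u)` past `t_v` creates the term `l u · l v · w`. The quadratic correction
  -- compensates for it, since `(l u + l v)²/2 - (l u)²/2 - (l v)²/2 = l u · l v`; this is where `p`
  -- must be odd.
  let F : (Fin n → ZMod p) → C.aut := fun v => m.t (v + (l v ^ 2 / 2) • w) * ψ ^ (l v).val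
  have hF : ∀ v, F v = m.t (v + (l v ^ 2 / 2) • w) * ψ ^ (l v).val := fun v => rfl
  have hFadd : ∀ u v, F (u + v) = F u * F v := by
    intro u v
    rw [hF, hF, hF, mul_assoc, ← mul_assoc (ψ ^ (l u).val), hψA, mul_assoc, ← hψadd, ← mul_assoc,
      ← m.t_add, ZMod.natCast_zmod_val, map_add l u v]
    congr 2
    rw [map_add, map_smul, hlw, smul_zero, add_zero]
    have h1 : (l u + l v) ^ 2 / 2 = l u ^ 2 / 2 + l v ^ 2 / 2 + l u * l v := by
      field_simp
      ring
    rw [h1, add_smul, add_smul]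
    abel
  have hFT : ∀ v, F v ∈ T ↔ v ∈ W := by
    intro v
    rw [← hlW, hF, T.mul_mem_cancel_left (m.t_mem _)]
    exact ⟨hψT _, fun h => by rw [h, ZMod.val_zero, pow_zero]; exact T.one_mem⟩
  -- If `F v` fixes the vertex `t_z(1)`, applying `l` to the resulting vector identity gives `l v =
  -- 0`, after which `F v` is the translation by `v`.
  have hFfix : ∀ v g, C.vhom (F v) g = g → v = 0 := by
    intro v g hg
    obtain ⟨z, rfl⟩ := m.exists_vhom_t_eq g
    rw [← C.vhom_mul_apply, hF, mul_assoc, hψA, ← mul_assoc, ← m.t_add, C.vhom_mul_apply, hψ1,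
      ZMod.natCast_zmod_val] at hg
    have h1 := m.eq_of_vhom_t_eq hg
    have h2 := congrArg l h1
    simp only [map_add, map_smul, hlw, smul_zero, add_zero] at h2
    rw [add_eq_right] at h2
    rw [h2] at h1
    simpa using h1
  let Φ : Multiplicative (Fin n → ZMod p) →* C.aut :=
    MonoidHom.mk' (fun v => F v.toAdd) fun u v => hFadd _ _
  have hΦ : Function.Injective Φ := by
    rw [injective_iff_map_eq_one]
    intro v hv
    refine hFfix v.toAdd 1 ?_
    change C.vhom (Φ v) 1 = 1
    rw [hv, C.vhom_one_apply]
  have hsurj : ∀ g, ∃ v, C.vhom (F v) 1 = g := by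
    have hb : Function.Bijective fun v => C.vhom (m.t v) 1 :=
      ⟨fun u v h => m.eq_of_vhom_t_eq h, m.exists_vhom_t_eq⟩
    let e := Equiv.ofBijective _ hb
    have hinj : Function.Injective fun v => C.vhom (F v) 1 := by
      intro u v huv
      have h1 : C.vhom (F (u - v)) (C.vhom (F v) 1) = C.vhom (F v) 1 := by
        rw [← C.vhom_mul_apply, ← hFadd, sub_add_cancel]
        exact huv
      exact sub_eq_zero.1 (hFfix _ _ h1)
    intro g
    obtain ⟨v, hv⟩ := Finite.surjective_of_injective (e.symm.injective.comp hinj) (e.symm g)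
    exact ⟨v, e.symm.injective hv⟩
  refine ⟨Φ.range, ?_, ⟨(MonoidHom.ofInjective hΦ).symm⟩, ?_⟩
  · refine (C.vertexRegular_iff _).2 ⟨fun g => ?_, ?_⟩
    · obtain ⟨v, hv⟩ := hsurj g
      exact ⟨F v, ⟨Multiplicative.ofAdd v, rfl⟩, hv⟩
    · rintro _ ⟨v, rfl⟩ g hg
      have h1 : v = 1 := hFfix _ _ hg
      rw [h1, map_one]
  · let e : (Fin (n - 1) → ZMod p) ≃ₗ[ZMod p] W := LinearEquiv.ofFinrankEq _ _ (by
      rw [finrank_fin_fun_zmod, hWr])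
    let Ψ : Multiplicative (Fin (n - 1) → ZMod p) →* C.aut :=
      Φ.comp (AddMonoidHom.toMultiplicative (W.subtype ∘ₗ e.toLinearMap).toAddMonoidHom)
    have hΨv : ∀ v, Ψ v = F (e v.toAdd) := fun v => rfl
    have hΨ : Function.Injective Ψ := by
      intro u v huv
      have h1 := hΦ huv
      exact e.injective (Subtype.ext h1)
    have hr : Ψ.range = T ⊓ Φ.range := by
      ext x
      constructor
      · rintro ⟨v, rfl⟩
        exact ⟨(hFT _).2 (e v.toAdd).2, _, rfl⟩
      · rintro ⟨hxT, v, rfl⟩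
        have h1 : v.toAdd ∈ W := (hFT _).1 hxT
        refine ⟨Multiplicative.ofAdd (e.symm ⟨_, h1⟩), ?_⟩
        rw [hΨv, toAdd_ofAdd, e.apply_symm_apply]
        rfl
    rw [← hr]
    exact ⟨(MonoidHom.ofInjective hΨ).symm⟩

end CayleyMap.TranslationModel

/-! ### Relabelling a map by a regular group of automorphisms -/

namespace CayleyMap

section Isomorphism

variable {G G' : Type*} [Group G] [Group G'] {C : CayleyMap G} {C' : CayleyMap G'}

theorem conj_mem_aut (D : C'.Dart ≃ C.Dart) (hrot : ∀ d, D (C'.rot d) = C.rot (D d))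
    (hrev : ∀ d, D (C'.rev d) = C.rev (D d)) (φ : C.aut) :
    (D.trans φ.1).trans D.symm ∈ C'.aut := by
  rw [mem_aut_iff]
  constructor <;> intro d
  · rw [← D.injective.eq_iff, hrot]
    simp only [Equiv.trans_apply, Equiv.apply_symm_apply]
    rw [hrot, C.aut_rot]
  · rw [← D.injective.eq_iff, hrev]
    simp only [Equiv.trans_apply, Equiv.apply_symm_apply]
    rw [hrev, C.aut_rev]

/-- An isomorphism of maps induces an isomorphism of the automorphism groups. -/
def autEquiv (D : C'.Dart ≃ C.Dart) (hrot : ∀ d, D (C'.rot d) = C.rot (D d))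
    (hrev : ∀ d, D (C'.rev d) = C.rev (D d)) : C.aut ≃* C'.aut where
  toFun φ := ⟨(D.trans φ.1).trans D.symm, conj_mem_aut D hrot hrev φ⟩
  invFun φ := ⟨(D.symm.trans φ.1).trans D, conj_mem_aut D.symm
    (fun d => by rw [D.symm_apply_eq, hrot, D.apply_symm_apply])
    (fun d => by rw [D.symm_apply_eq, hrev, D.apply_symm_apply]) φ⟩
  left_inv φ := Subtype.ext (Equiv.ext fun d => by simp)
  right_inv φ := Subtype.ext (Equiv.ext fun d => by simp)
  map_mul' φ ψ := Subtype.ext (Equiv.ext fun d => by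
    simp only [Equiv.trans_apply, Subgroup.coe_mul, Equiv.Perm.mul_apply, Equiv.apply_symm_apply])

theorem apply_autEquiv (D : C'.Dart ≃ C.Dart) (hrot : ∀ d, D (C'.rot d) = C.rot (D d))
    (hrev : ∀ d, D (C'.rev d) = C.rev (D d)) (φ : C.aut) (d : C'.Dart) :
    D ((autEquiv D hrot hrev φ).1 d) = φ.1 (D d) :=
  D.apply_symm_apply _

end Isomorphism

section Transfer

variable {G : Type*} [Group G] (C : CayleyMap G) [Nonempty C.S] {H : Subgroup C.aut}
  (hH : C.VertexRegular H)

/-- The elements of a vertex-regular subgroup that move the vertex `1` to one of its neighbours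
correspond to these neighbours. -/
noncomputable def neighbourEquiv : {h : H | C.vhom h.1 1 ∈ C.S} ≃ C.S :=
  Equiv.ofBijective (fun h => ⟨C.vhom h.1.1 1, h.2⟩) ⟨fun a b hab =>
    Subtype.ext (Subtype.ext (hH.eq_of_vhom_eq a.1.2 b.1.2 (congrArg Subtype.val hab))),
    fun s => by
      obtain ⟨h, hh, hs⟩ := ((C.vertexRegular_iff H).1 hH).1 s
      have hs' : C.vhom h 1 ∈ C.S := hs ▸ s.2
      exact ⟨⟨⟨h, hh⟩, hs'⟩, Subtype.ext hs⟩⟩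

theorem neighbourEquiv_apply (h : {h : H | C.vhom h.1 1 ∈ C.S}) :
    (C.neighbourEquiv hH h : G) = C.vhom h.1.1 1 := rfl

/-- The dart from `s` back to `1` is sent by `φ⁻¹` to a dart leaving `1`. This makes the new
connection set closed under inverses. -/
theorem inv_apply_neighbour (φ : C.aut) (s : C.S) (hs : C.vhom φ 1 = s) :
    φ⁻¹.1 ((s : G), ⟨(s : G)⁻¹, C.inv_mem _ s.2⟩) =
      (1, (φ⁻¹.1 ((s : G), ⟨(s : G)⁻¹, C.inv_mem _ s.2⟩)).2) ∧
    C.vhom φ⁻¹ 1 = (φ⁻¹.1 ((s : G), ⟨(s : G)⁻¹, C.inv_mem _ s.2⟩)).2 := by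
  have h1 : C.vhom φ⁻¹ s = 1 := C.vhom_inv_apply_eq φ hs
  have h2 := C.vhom_mul_dart φ⁻¹ s ⟨(s : G)⁻¹, C.inv_mem _ s.2⟩
  rw [h1, one_mul, mul_inv_cancel] at h2
  exact ⟨C.vhom_eq_apply _ h1 _, h2⟩

/-- A map with a vertex-regular group `H` of automorphisms, as a Cayley map of `H`. -/
noncomputable def transfer : CayleyMap H where
  S := {h : H | C.vhom h.1 1 ∈ C.S}
  closure_eq_top := by
    rw [eq_top_iff]
    rintro h -
    obtain ⟨_, ⟨k, hk, rfl⟩, hk1⟩ := C.exists_vhom_eq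
      ((Subgroup.closure {h : H | C.vhom h.1 1 ∈ C.S}).map H.subtype) (fun s => by
        refine ⟨_, ⟨((C.neighbourEquiv hH).symm s).1,
          Subgroup.subset_closure ((C.neighbourEquiv hH).symm s).2, rfl⟩, ?_⟩
        have := C.neighbourEquiv_apply hH ((C.neighbourEquiv hH).symm s)
        rw [Equiv.apply_symm_apply] at this
        exact this.symm) (C.vhom h.1 1)
    rwa [← Subtype.ext (hH.eq_of_vhom_eq k.2 h.2 hk1)]
  inv_mem := by
    intro h hh
    have := (C.inv_apply_neighbour h.1 ⟨_, hh⟩ rfl).2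
    change C.vhom h.1⁻¹ 1 ∈ C.S
    rw [this]
    exact Subtype.coe_prop _
  one_notMem := fun h => C.one_notMem h
  ρ := (C.neighbourEquiv hH).symm.permCongrHom C.ρ
  sameCycle s t := by
    obtain ⟨i, hi⟩ := C.sameCycle (C.neighbourEquiv hH s) (C.neighbourEquiv hH t)
    refine ⟨i, ?_⟩
    rw [← map_zpow]
    change (C.neighbourEquiv hH).symm ((C.ρ ^ i) (C.neighbourEquiv hH s)) = t
    rw [hi, Equiv.symm_apply_apply]

theorem neighbourEquiv_transfer_ρ (s : (C.transfer hH).S) :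
    C.neighbourEquiv hH ((C.transfer hH).ρ s) = C.ρ (C.neighbourEquiv hH s) :=
  (C.neighbourEquiv hH).apply_symm_apply _

/-- The isomorphism of a map with the Cayley map of a vertex-regular group of automorphisms. -/
noncomputable def transferDart : (C.transfer hH).Dart ≃ C.Dart :=
  Equiv.ofBijective (fun d => d.1.1.1 (1, C.neighbourEquiv hH d.2)) <| by
    constructor
    · rintro ⟨h, s⟩ ⟨k, t⟩ hst
      have h1 := congrArg Prod.fst hst
      obtain rfl : h = k := by
        refine Subtype.ext (hH.eq_of_vhom_eq h.2 k.2 (g := 1) ?_)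
        exact (C.fst_apply _ _ _).symm.trans (h1.trans (C.fst_apply _ _ _))
      have h2 := congrArg Prod.snd (h.1.1.injective hst)
      obtain rfl : s = t := (C.neighbourEquiv hH).injective h2
      rfl
    · rintro ⟨g, s⟩
      obtain ⟨h, hh, rfl⟩ := ((C.vertexRegular_iff H).1 hH).1 g
      refine ⟨(⟨h, hh⟩, (C.neighbourEquiv hH).symm (h⁻¹.1 (C.vhom h 1, s)).2), ?_⟩
      have h1 := C.vhom_eq_apply h⁻¹ (C.vhom_inv_apply_eq h (g := 1) rfl) s
      simp only [Equiv.apply_symm_apply]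
      rw [← h1]
      exact h.1.apply_symm_apply _

theorem transferDart_apply (h : H) (s : (C.transfer hH).S) :
    C.transferDart hH (h, s) = h.1.1 (1, C.neighbourEquiv hH s) := rfl

theorem transferDart_rot (d : (C.transfer hH).Dart) :
    C.transferDart hH ((C.transfer hH).rot d) = C.rot (C.transferDart hH d) := by
  obtain ⟨h, s⟩ := d
  change h.1.1 (1, C.neighbourEquiv hH ((C.transfer hH).ρ s)) = C.rot (h.1.1 (1, _))
  rw [neighbourEquiv_transfer_ρ, ← C.aut_rot]
  rfl

theorem transferDart_rev (d : (C.transfer hH).Dart) :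
    C.transferDart hH ((C.transfer hH).rev d) = C.rev (C.transferDart hH d) := by
  obtain ⟨h, s⟩ := d
  set u := C.neighbourEquiv hH s with hu
  obtain ⟨h1, h2⟩ := C.inv_apply_neighbour s.1.1 u (C.neighbourEquiv_apply hH s).symm
  have h3 : C.neighbourEquiv hH ⟨(s : H)⁻¹, (C.transfer hH).inv_mem _ s.2⟩ =
      (s.1.1⁻¹.1 ((u : G), ⟨(u : G)⁻¹, C.inv_mem _ u.2⟩)).2 := Subtype.ext h2
  change (h.1 * s.1.1).1 (1, C.neighbourEquiv hH ⟨(s : H)⁻¹, _⟩) = C.rev (h.1.1 (1, u))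
  rw [h3, ← h1, ← C.aut_rev]
  change h.1.1 (s.1.1.1 (s.1.1.1⁻¹ _)) = h.1.1 _
  congr 1
  refine (s.1.1.1.apply_symm_apply _).trans ?_
  exact Prod.ext (one_mul _).symm rfl

/-- The automorphism group of the transferred map. -/
noncomputable def transferAut : C.aut ≃* (C.transfer hH).aut :=
  autEquiv (C.transferDart hH) (C.transferDart_rot hH) (C.transferDart_rev hH)

theorem transferDart_transferAut (φ : C.aut) (d : (C.transfer hH).Dart) :
    C.transferDart hH ((C.transferAut hH φ).1 d) = φ.1 (C.transferDart hH d) :=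
  apply_autEquiv _ _ _ φ d

/-- Left translation by `h` in the relabelled map is `h` itself transported along the isomorphism.
-/
theorem map_transferAut_eq_groupImage :
    H.map (C.transferAut hH).toMonoidHom = (C.transfer hH).groupImage := by
  have key : ∀ h : H, (C.transfer hH).leftHom h = C.transferAut hH h.1 := by
    intro h
    refine Subtype.ext (Equiv.ext fun d => (C.transferDart hH).injective ?_)
    rw [transferDart_transferAut]
    rfl
  ext x
  constructor
  · rintro ⟨h, hh, rfl⟩
    exact ⟨⟨h, hh⟩, key _⟩
  · rintro ⟨h, rfl⟩
    exact ⟨h.1, h.2, (key h).symm⟩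

theorem isRegular_transfer (hC : C.IsRegular) : (C.transfer hH).IsRegular := by
  intro d d'
  obtain ⟨φ, hφ, h⟩ := hC (C.transferDart hH d) (C.transferDart hH d')
  refine ⟨_, (C.transferAut hH ⟨φ, hφ⟩).2, (C.transferDart hH).injective ?_⟩
  rw [transferDart_transferAut]
  exact h

theorem nonempty_transfer_S : Nonempty (C.transfer hH).S :=
  ⟨(C.neighbourEquiv hH).symm (Classical.arbitrary C.S)⟩

theorem vhom_vhom_transferAut [Nonempty (C.transfer hH).S] (φ : C.aut) (h : H) :
    C.vhom ((C.transfer hH).vhom (C.transferAut hH φ) h).1 1 = C.vhom φ (C.vhom h.1 1) := by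
  let s := Classical.arbitrary (C.transfer hH).S
  have h1 := congrArg Prod.fst (C.transferDart_transferAut hH φ (h, s))
  have h2 := (C.transfer hH).fst_apply (C.transferAut hH φ) h s
  rw [← h2]
  refine (C.fst_apply _ 1 _).symm.trans (h1.trans ?_)
  refine Eq.trans ?_ (C.vhom_mul_apply φ h.1 1)
  exact C.fst_apply (φ * h.1) 1 _

theorem vertexRegular_map_transferAut {T : Subgroup C.aut} (hT : C.VertexRegular T) :
    (C.transfer hH).VertexRegular (T.map (C.transferAut hH).toMonoidHom) := by
  have := C.nonempty_transfer_S hH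
  obtain ⟨h1, h2⟩ := (C.vertexRegular_iff T).1 hT
  refine ((C.transfer hH).vertexRegular_iff _).2 ⟨fun h => ?_, ?_⟩
  · obtain ⟨t, ht, ht1⟩ := h1 (C.vhom h.1 1)
    refine ⟨_, ⟨t, ht, rfl⟩, Subtype.ext (hH.eq_of_vhom_eq (Subtype.coe_prop _) h.2 (g := 1) ?_)⟩
    rw [← ht1]
    exact C.vhom_vhom_transferAut hH t 1
  · rintro _ ⟨t, ht, rfl⟩ h hh
    have h3 := C.vhom_vhom_transferAut hH t h
    change (C.transfer hH).vhom (C.transferAut hH t) h = h at hh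
    rw [hh] at h3
    rw [h2 t ht _ h3.symm, map_one]

theorem actsAs_transfer {n p : ℕ} {T : Subgroup C.aut} {σ : GLnp n p} (hT : C.ActsAs T σ) :
    (C.transfer hH).ActsAs (T.map (C.transferAut hH).toMonoidHom) σ := by
  obtain ⟨hn, hreg, r, hr, e, he⟩ := hT
  refine ⟨hn.map _ (C.transferAut hH).surjective, C.vertexRegular_map_transferAut hH hreg,
    C.transferAut hH r, fun s => (C.transferDart hH).injective ?_,
    e.trans (T.equivMapOfInjective _ (C.transferAut hH).injective), fun v => ?_⟩
  · rw [transferDart_transferAut, transferDart_apply, transferDart_apply,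
      neighbourEquiv_transfer_ρ]
    exact hr _
  · have := congrArg (C.transferAut hH) (he v)
    rwa [map_mul, map_mul, map_inv] at this

end Transfer

/-! ### The Cayley map on the orbit of a cyclic vector -/

section OrbitMap

variable {n p : ℕ} (σ : GLnp n p)

/-- The action of `σ` on the multiplicative version of `𝔽_p^n`. -/
def mulAct : Multiplicative (Fin n → ZMod p) ≃* Multiplicative (Fin n → ZMod p) :=
  AddEquiv.toMultiplicative
    (LinearMap.GeneralLinearGroup.generalLinearEquiv (ZMod p) (Fin n → ZMod p) σ).toAddEquiv

variable (v : Fin n → ZMod p)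

/-- The orbit of `v` under the powers of `σ`. -/
def orbitSet : Set (Multiplicative (Fin n → ZMod p)) :=
  {x | ∃ i : ℤ, ((σ ^ i : GLnp n p) : Module.End (ZMod p) (Fin n → ZMod p)) v = x.toAdd}

/-- The action of `σ` on an orbit. -/
def orbitPerm : Equiv.Perm (orbitSet σ v) :=
  (mulAct σ).toEquiv.subtypeEquiv fun x => by
    constructor
    · rintro ⟨i, hi⟩
      refine ⟨1 + i, ?_⟩
      rw [zpow_one_add, Units.val_mul, Module.End.mul_apply, hi]
      rfl
    · rintro ⟨i, hi⟩
      refine ⟨-1 + i, ?_⟩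
      rw [zpow_add, zpow_neg_one, Units.val_mul, Module.End.mul_apply, hi]
      change ((σ⁻¹ : GLnp n p) : Module.End (ZMod p) (Fin n → ZMod p))
        ((σ : Module.End (ZMod p) (Fin n → ZMod p)) x.toAdd) = x.toAdd
      rw [← Module.End.mul_apply, Units.inv_mul, Module.End.one_apply]

theorem orbitPerm_zpow_apply (i : ℤ) (x : orbitSet σ v) :
    ((orbitPerm σ v ^ i) x : Multiplicative (Fin n → ZMod p)).toAdd =
      ((σ ^ i : GLnp n p) : Module.End (ZMod p) (Fin n → ZMod p)) x.1.toAdd := by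
  induction i generalizing x with
  | zero => simp
  | succ i ih =>
    rw [zpow_add_one, zpow_add_one, Equiv.Perm.mul_apply, ih, Units.val_mul, Module.End.mul_apply]
    rfl
  | pred i ih =>
    rw [zpow_sub_one, zpow_sub_one, Equiv.Perm.mul_apply, ih, Units.val_mul, Module.End.mul_apply]
    rfl

/-- The Cayley map of `𝔽_p^n` whose connection set is the orbit of a cyclic vector of `σ`. -/
def orbitCayleyMap [Fact p.Prime] (hn : 1 ≤ n)
    (hv : ∀ w, ∃ q : (ZMod p)[X], aeval (σ : Module.End (ZMod p) (Fin n → ZMod p)) q v = w)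
    (hneg : (-1 : GLnp n p) ∈ Subgroup.zpowers σ) :
    CayleyMap (Multiplicative (Fin n → ZMod p)) where
  S := orbitSet σ v
  closure_eq_top := by
    rw [eq_top_iff]
    rintro x -
    obtain ⟨q, hq⟩ := hv x.toAdd
    obtain rfl : Multiplicative.ofAdd _ = x := congrArg Multiplicative.ofAdd hq
    clear hq
    induction q using Polynomial.induction_on' with
    | add q q' h h' =>
      rw [map_add, LinearMap.add_apply, ofAdd_add]
      exact Subgroup.mul_mem _ h h'
    | monomial k a =>
      -- Scalars of the prime field are integer multiples, so the additive subgroup generated by the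
      -- orbit contains the cyclic submodule.
      have h1 : aeval (σ : Module.End (ZMod p) (Fin n → ZMod p)) (monomial k a) v =
          a.val • ((σ ^ k : GLnp n p) : Module.End (ZMod p) (Fin n → ZMod p)) v := by
        rw [aeval_monomial, Module.End.mul_apply, Module.algebraMap_end_apply,
          Units.val_pow_eq_pow_val, ← Nat.cast_smul_eq_nsmul (ZMod p), ZMod.natCast_zmod_val]
      rw [h1, ofAdd_nsmul]
      have h2 : Multiplicative.ofAdd ((σ ^ k : GLnp n p).val v) ∈ orbitSet σ v :=
        ⟨k, by rw [zpow_natCast]; rfl⟩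
      exact Subgroup.pow_mem _ (Subgroup.subset_closure h2) _
  inv_mem := by
    rintro x ⟨i, hi⟩
    obtain ⟨k, hk⟩ := Subgroup.mem_zpowers_iff.1 hneg
    refine ⟨k + i, ?_⟩
    rw [zpow_add, Units.val_mul, Module.End.mul_apply, hi, hk, Units.val_neg, Units.val_one,
      LinearMap.neg_apply, Module.End.one_apply, toAdd_inv]
  one_notMem := by
    rintro ⟨i, hi⟩
    have hv0 : v = 0 := by
      have h1 : ((σ ^ i)⁻¹ : GLnp n p).val ((σ ^ i : GLnp n p).val v) = v := by
        rw [← Module.End.mul_apply, Units.inv_mul, Module.End.one_apply]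
      rw [← h1, hi, toAdd_one, map_zero]
    obtain ⟨q, hq⟩ := hv fun _ => 1
    rw [hv0, map_zero] at hq
    exact zero_ne_one (congrFun hq ⟨0, hn⟩)
  ρ := orbitPerm σ v
  sameCycle := by
    rintro ⟨x, i, hi⟩ ⟨y, k, hk⟩
    refine ⟨k - i, Subtype.ext (Multiplicative.toAdd.injective ?_)⟩
    rw [orbitPerm_zpow_apply]
    change (σ ^ (k - i)).val x.toAdd = y.toAdd
    rw [← hi, ← hk, ← Module.End.mul_apply, ← Units.val_mul, ← zpow_add, sub_add_cancel]

variable [Fact p.Prime] (hn : 1 ≤ n)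
  (hv : ∀ w, ∃ q : (ZMod p)[X], aeval (σ : Module.End (ZMod p) (Fin n → ZMod p)) q v = w)
  (hneg : (-1 : GLnp n p) ∈ Subgroup.zpowers σ)

theorem nonempty_orbitCayleyMap_S : Nonempty (orbitCayleyMap σ v hn hv hneg).S :=
  ⟨⟨Multiplicative.ofAdd v, 0, rfl⟩⟩

/-- The automorphism of the orbit map that `σ` induces. -/
def orbitRotation : (orbitCayleyMap σ v hn hv hneg).aut :=
  ⟨Equiv.prodCongr (mulAct σ).toEquiv (orbitPerm σ v), by
    rw [mem_aut_iff]
    refine ⟨fun d => rfl, fun d => Prod.ext ?_ (Subtype.ext ?_)⟩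
    · exact map_mul (mulAct σ) d.1 d.2.1
    · exact map_inv (mulAct σ) d.2.1⟩

theorem orbitRotation_apply (s : (orbitCayleyMap σ v hn hv hneg).S) :
    (orbitRotation σ v hn hv hneg).1 (1, s) = (1, (orbitCayleyMap σ v hn hv hneg).ρ s) :=
  Prod.ext (map_one (mulAct σ)) rfl

theorem orbitRotation_mul_leftHom (x : Multiplicative (Fin n → ZMod p)) :
    orbitRotation σ v hn hv hneg * (orbitCayleyMap σ v hn hv hneg).leftHom x =
      (orbitCayleyMap σ v hn hv hneg).leftHom (mulAct σ x) * orbitRotation σ v hn hv hneg :=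
  Subtype.ext (Equiv.ext fun d => Prod.ext (map_mul (mulAct σ) x d.1) rfl)

theorem isRegular_orbitCayleyMap : (orbitCayleyMap σ v hn hv hneg).IsRegular := by
  have hr := orbitRotation_apply σ v hn hv hneg
  generalize orbitRotation σ v hn hv hneg = r at *
  generalize orbitCayleyMap σ v hn hv hneg = C at *
  rintro ⟨g, s⟩ ⟨g', s'⟩
  obtain ⟨i, hi⟩ := C.sameCycle s s'
  refine ⟨_, (C.leftHom g' * r ^ i * C.leftHom g⁻¹).2, ?_⟩
  have h1 : (C.leftHom g⁻¹).1 (g, s) = (1, s) := Prod.ext (inv_mul_cancel g) rfl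
  change (C.leftHom g').1 ((r ^ i : C.aut).1 ((C.leftHom g⁻¹).1 (g, s))) = _
  rw [h1, zpow_apply_of_localRotation hr, hi]
  exact Prod.ext (mul_one g') rfl

/-- Every automorphism is a translation times a power of the rotation induced by `σ`, and the latter
normalises the translations. -/
theorem actsAs_orbitCayleyMap : (orbitCayleyMap σ v hn hv hneg).ActsAs
    (orbitCayleyMap σ v hn hv hneg).groupImage σ := by
  have := nonempty_orbitCayleyMap_S σ v hn hv hneg
  have hreg := (orbitCayleyMap σ v hn hv hneg).vertexRegular_groupImage
  have hconj := orbitRotation_mul_leftHom σ v hn hv hneg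
  have hr := orbitRotation_apply σ v hn hv hneg
  generalize orbitRotation σ v hn hv hneg = r at *
  generalize orbitCayleyMap σ v hn hv hneg = C at *
  have hrN : r ∈ Subgroup.normalizer (C.groupImage : Set C.aut) := by
    rw [Subgroup.mem_normalizer_iff]
    intro x
    constructor
    · rintro ⟨y, rfl⟩
      exact ⟨mulAct σ y, by rw [hconj, mul_inv_cancel_right]⟩
    · rintro ⟨y, hy⟩
      refine ⟨(mulAct σ).symm y, ?_⟩
      apply mul_left_cancel (a := r)
      rw [hconj, MulEquiv.apply_symm_apply, hy, inv_mul_cancel_right]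
  refine ⟨?_, hreg, r, hr, MonoidHom.ofInjective C.leftHom_injective, fun w => ?_⟩
  · rw [← Subgroup.normalizer_eq_top_iff, eq_top_iff]
    rintro φ -
    obtain ⟨t, ht, ht1⟩ := ((C.vertexRegular_iff _).1 hreg).1 (C.vhom φ 1)
    obtain ⟨i, hi⟩ := exists_zpow_eq_of_vhom_one hr (t⁻¹ * φ) (by
      rw [C.vhom_mul_apply, C.vhom_inv_apply_eq t ht1])
    rw [← mul_inv_cancel_left t φ, hi]
    exact Subgroup.mul_mem _ (Subgroup.le_normalizer ht) (Subgroup.zpow_mem _ hrN i)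
  · rw [eq_mul_inv_iff_mul_eq]
    exact (hconj (Multiplicative.ofAdd w)).symm

end OrbitMap

end CayleyMap

/-! ### The intersection criterion and the main theorem -/

theorem IsElemAb.nontrivial {n p : ℕ} [Fact p.Prime] (hn : 1 ≤ n) {G : Type*} [Group G]
    (h : IsElemAb p n G) : Nontrivial G := by
  obtain ⟨e⟩ := h
  have : Nonempty (Fin n) := ⟨⟨0, hn⟩⟩
  exact (e.toEquiv.trans Multiplicative.toAdd).nontrivial

theorem exists_intersection_iff {n p : ℕ} [Fact p.Prime] (hn : 1 ≤ n) {G : Type} [Group G]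
    {C : CayleyMap G} {T : Subgroup C.aut} {σ : GLnp n p} (hG : IsElemAb p n G)
    (hT : C.ActsAs T σ) :
    (∃ H : Subgroup C.aut, C.VertexRegular H ∧ IsElemAb p n H ∧
      IsElemAb p (n - 1) (T ⊓ H : Subgroup C.aut)) ↔
    p ≠ 2 ∧ HasMType σ ∧ FixesHyperplane σ := by
  have := hG.nontrivial hn
  have := C.nonempty_S
  obtain ⟨m⟩ := hT.nonempty_translationModel
  constructor
  · rintro ⟨H, h1, h2, h3⟩
    obtain ⟨h4, h5⟩ := m.fixesHyperplane hn h1 h2 h3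
    exact ⟨h4, m.hasMType, h5⟩
  · rintro ⟨h1, -, h2⟩
    exact m.exists_vertexRegular hn h1 h2

/-- Necessity applies the criterion to `H = G`. For sufficiency the orbit map has `T = G`; the
criterion supplies a different regular subgroup `H`, and relabelling by `H` moves the old group into
the role of `T`. -/
theorem properIntersectionCase_iff {n p : ℕ} [Fact p.Prime] (hn : 1 ≤ n) (σ : GLnp n p) :
    ProperIntersectionCase σ ↔ p ≠ 2 ∧ HasMType σ ∧ FixesHyperplane σ := by
  constructor
  · rintro ⟨G, _, C, T, hG, -, hT, hI⟩
    have := hG.nontrivial hn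
    have := C.nonempty_S
    refine (exists_intersection_iff hn hG hT).1 ⟨_, C.vertexRegular_groupImage, ?_, hI⟩
    obtain ⟨e⟩ := hG
    exact ⟨(MonoidHom.ofInjective C.leftHom_injective).symm.trans e⟩
  · intro h
    obtain ⟨v, hv⟩ := Module.End.exists_cyclic_vector
      (σ : Module.End (ZMod p) (Fin n → ZMod p)) (by rw [finrank_fin_fun_zmod]; exact h.2.1.1)
    let C := CayleyMap.orbitCayleyMap σ v hn hv h.2.1.2
    have hT : C.ActsAs C.groupImage σ := CayleyMap.actsAs_orbitCayleyMap σ v hn hv h.2.1.2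
    have : Nonempty C.S := CayleyMap.nonempty_orbitCayleyMap_S σ v hn hv h.2.1.2
    obtain ⟨H, hH, hH1, e⟩ := (exists_intersection_iff hn ⟨MulEquiv.refl _⟩ hT).2 h
    refine ⟨H, inferInstance, C.transfer hH, _, hH1,
      C.isRegular_transfer hH (CayleyMap.isRegular_orbitCayleyMap σ v hn hv h.2.1.2),
      C.actsAs_transfer hH hT, ?_⟩
    rw [← C.map_transferAut_eq_groupImage hH,
      ← Subgroup.map_inf _ _ _ (C.transferAut hH).injective]
    obtain ⟨e⟩ := e
    exact ⟨(Subgroup.equivMapOfInjective _ _ (C.transferAut hH).injective).symm.trans e⟩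

theorem theorem1p3 (n p : ℕ) [Fact p.Prime] (hn : 1 ≤ n) (M : Set (GLnp n p)) (hM : IsBoldM M) :
    (p ≠ 2 →
      minPoly '' M =
        {f | ∃ j ∈ Finset.Icc 1 (dMax n p), ∃ k : (ZMod p)[X] → ℕ, IsFactorization n p j k f} ∧
      minPoly '' boldM₁ M =
        {f | ∃ σ ∈ M, minPoly σ = f ∧
          ∃ j ∈ Finset.Icc 1 (dMax n p), ∃ k : (ZMod p)[X] → ℕ,
            IsFactorization n p j k f ∧ HasDominantLinearFactor n p j (orderOf σ) k}) ∧
    (∀ σ : GLnp n p,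
      (ProperIntersectionCase σ ↔ p ≠ 2 ∧ ∃ τ ∈ boldM₁ M, IsConj σ τ) ∧
      (ProperIntersectionCase σ ↔ p ≠ 2 ∧ minPoly σ ∈ minPoly '' boldM₁ M)) ∧
    (∀ (G : Type) [Group G] (C : CayleyMap G) (T : Subgroup C.aut) (σ : GLnp n p),
      IsElemAb p n G → C.IsRegular → C.ActsAs T σ →
        ((∃ H : Subgroup C.aut, C.VertexRegular H ∧ IsElemAb p n H ∧
            IsElemAb p (n - 1) (T ⊓ H : Subgroup C.aut)) ↔
          p ≠ 2 ∧ ∃ τ ∈ boldM₁ M, IsConj σ τ)) := by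
  refine ⟨fun hp => ⟨image_minPoly_eq hp hn hM, image_minPoly_boldM₁_eq hp hn hM⟩,
    fun σ => ?_, fun G _ C T σ hG _ hT => ?_⟩
  · rw [minPoly_mem_image_boldM₁_iff hM, exists_mem_boldM₁_iff hM, and_self]
    exact properIntersectionCase_iff hn σ
  · rw [exists_mem_boldM₁_iff hM]
    exact exists_intersection_iff hn hG hT
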